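/- **Definitions.** A QAC circuit of depth $d$ on a finite set $Q$ of qubits is a product of unitaries $C = L_d M_d \cdots L_1 M_1 L_0$, where each $L_k$ is a tensor product of arbitrary single-qubit unitaries and each $M_k$ is a product of $\mathrm{CZ}$ gates with pairwise disjoint supports; the $\mathrm{CZ}$ gate with support $S \subseteq Q$ maps $|x\rangle$ to $-|x\rangle$ if $x_q = 1$ for all $q \in S$, and fixes $|x\rangle$ otherwise. A $(w,m)$-2D-QAC circuit (a 2D-QAC circuit of width $w$) is a QAC circuit whose qubits are arranged in a lattice with $w$ rows of length $m$, and in which the support of each $\mathrm{CZ}$ gate is an interval of consecutive qubits of one row or of one column. A 1D-QAC circuit on $m$ qubits is a $(1,m)$-2D-QAC circuit. The parity unitary $U_{\oplus_n}$ acts on $n+1$ qubits by $U_{\oplus_n}|x,b\rangle = |x,\, b \oplus x_1 \oplus \cdots \oplus x_n\rangle$ for $x \in \{0,1\}^n$, $b \in \{0,1\}$. A circuit $C$ synthesizes $U_{\oplus_n}$ if, for some placement of these $n+1$ qubits among the qubits of $C$, with the other $a$ qubits of $C$ as ancilla qubits, $C(|\phi\rangle \otimes |0^a\rangle) = (U_{\oplus_n}|\phi\rangle)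 \otimes |0^a\rangle$ for every $(n+1)$-qubit state $|\phi\rangle$. **Theorem.** 1. For every integer $n \ge 1$ there is a 1D-QAC circuit of depth $n$ on $n+1$ qubits (that is, with no ancilla qubits) that synthesizes $U_{\oplus_n}$. 2. There are functions $d(n) = O(\log n)$ and $m(n) = n^{O(1)}$ (as $n \to \infty$) such that for every $n \ge 1$ there is a $(2, m(n))$-2D-QAC circuit of depth $d(n)$ that synthesizes $U_{\oplus_n}$. 3. There are functions $d(n) = O\!\left(\frac{\log n}{\log\log n}\right)$, $w(n) = n^{O(1)}$ and $m(n) = n^{O(1)}$ (as $n \to \infty$) such that for every $n \ge 1$ there is a $(w(n), m(n))$-2D-QAC circuit of depth $d(n)$ that synthesizes $U_{\oplus_n}$. -/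

import Mathlib

namespace QAC

/-- Operators on the Hilbert space of the qubits `Q`, as matrices in the computational basis
`|x⟩`, where `x : Q → Bool`. -/
abbrev Operator (Q : Type) : Type := Matrix (Q → Bool) (Q → Bool) ℂ

/-- The tensor product over all qubits `q` of the single-qubit unitaries `u q`. -/
def tensorUnitary {Q : Type} [Fintype Q] (u : Q → Matrix.unitaryGroup Bool ℂ) : Operator Q :=
  Matrix.of fun x y => ∏ q, (u q : Matrix Bool Bool ℂ) (x q) (y q)

/-- The `CZ` gate with support `S`: it multiplies `|x⟩` by `-1` if all qubits of `S` are `1` in `x`,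
and fixes `|x⟩` otherwise. -/
def czGate {Q : Type} [DecidableEq Q] [Fintype Q] (S : Finset Q) : Operator Q :=
  Matrix.diagonal fun x => if ∀ q ∈ S, x q = true then -1 else 1

/-- One step `L M` of a circuit: a layer `M` of `CZ` gates with pairwise disjoint (nonempty)
supports, followed by a layer `L` of arbitrary single-qubit unitaries. -/
structure Layer (Q : Type) where
  gates : Finset (Finset Q)
  gates_nonempty : ∀ S ∈ gates, S.Nonempty
  gates_disjoint : ∀ S ∈ gates, ∀ T ∈ gates, S ≠ T → Disjoint S T
  single : Q → Matrix.unitaryGroup Bool ℂ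

/-- `CZ` gates are diagonal, so that they commute. -/
theorem czGate_commute {Q : Type} [DecidableEq Q] [Fintype Q] (S T : Finset Q) :
    Commute (czGate S) (czGate T) :=
  Matrix.commute_diagonal _ _

/-- The operator `L M` of a layer; `M` is the product of its `CZ` gates. -/
def Layer.operator {Q : Type} [DecidableEq Q] [Fintype Q] (l : Layer Q) : Operator Q :=
  tensorUnitary l.single *
    l.gates.noncommProd czGate (fun S _ T _ _ => czGate_commute S T)

/-- A QAC circuit `L_d M_d ⋯ L_1 M_1 L_0` on the qubits `Q`. The list `layers` is in order of
application: its head is `L_1 M_1`. -/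
structure Circuit (Q : Type) where
  initial : Q → Matrix.unitaryGroup Bool ℂ
  layers : List (Layer Q)

/-- The depth of a circuit is its number of layers of `CZ` gates. -/
def Circuit.depth {Q : Type} (C : Circuit Q) : ℕ := C.layers.length

/-- The operator `L_d M_d ⋯ L_1 M_1 L_0` implemented by a circuit. -/
def Circuit.operator {Q : Type} [DecidableEq Q] [Fintype Q] (C : Circuit Q) : Operator Q :=
  C.layers.foldl (fun A l => l.operator * A) (tensorUnitary C.initial)

/-- A set of qubits of the `w × m` lattice is a line interval if it consists of consecutive qubits
of one row, or of consecutive qubits of one column. -/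
def IsLineInterval {w m : ℕ} (S : Finset (Fin w × Fin m)) : Prop :=
  (∃ (i : Fin w) (a b : Fin m), S = {i} ×ˢ Finset.Icc a b) ∨
    (∃ (a b : Fin w) (j : Fin m), S = Finset.Icc a b ×ˢ {j})

/-- `(w, m)`-2D-QAC circuits: the qubits `(i, j)` form a lattice with `w` rows of length `m`, and
each `CZ` gate acts on an interval of a row or of a column. The number `w` is the width. -/
structure Circuit2D (w m : ℕ) extends Circuit (Fin w × Fin m) where
  isLocal : ∀ l ∈ layers, ∀ S ∈ l.gates, IsLineInterval S

/-- 1D-QAC circuits on `m` qubits: 2D-QAC circuits of width `1`. -/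
abbrev Circuit1D (m : ℕ) : Type := Circuit2D 1 m

/-- The vector `|φ⟩ ⊗ |0^a⟩` on the qubits `Q`, where the `i`-th qubit of `φ` is placed at `e i` and
the other qubits of `Q` are the ancilla qubits. -/
def withAncilla {Q : Type} [DecidableEq Q] [Fintype Q] {k : ℕ} (e : Fin k ↪ Q)
    (φ : (Fin k → Bool) → ℂ) : (Q → Bool) → ℂ :=
  fun z => if ∀ q, q ∉ Finset.univ.map e → z q = false then φ (z ∘ e) else 0

/-- With its `k` input qubits placed by `e`, the circuit `C` synthesizes `U` exactly and cleanly: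
`C (|φ⟩ ⊗ |0^a⟩) = (U |φ⟩) ⊗ |0^a⟩` for all `φ`. -/
def Circuit.SynthesizesAt {Q : Type} [DecidableEq Q] [Fintype Q] (C : Circuit Q) {k : ℕ}
    (e : Fin k ↪ Q) (U : Operator (Fin k)) : Prop :=
  ∀ φ : (Fin k → Bool) → ℂ,
    C.operator.mulVec (withAncilla e φ) = withAncilla e (U.mulVec φ)

/-- `C` synthesizes `U` exactly and cleanly, for some placement of the input qubits. -/
def Circuit.Synthesizes {Q : Type} [DecidableEq Q] [Fintype Q] (C : Circuit Q) {k : ℕ}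
    (U : Operator (Fin k)) : Prop :=
  ∃ e : Fin k ↪ Q, C.SynthesizesAt e U

/-- The unitary `U_f |x, b⟩ = |x, b ⊕ f x⟩` on `n + 1` qubits; the target `b` is the last one. -/
def functionUnitary {n : ℕ} (f : (Fin n → Bool) → Bool) : Operator (Fin (n + 1)) :=
  Matrix.of fun y z =>
    if y = Function.update z (Fin.last n) (xor (z (Fin.last n)) (f fun i => z i.castSucc))
    then 1 else 0

/-- The parity of `n` bits. -/
def parity {n : ℕ} (x : Fin n → Bool) : Bool :=
  decide (Odd (Finset.univ.filter fun i => x i = true).card)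

/-- The parity unitary `|x, b⟩ ↦ |x, b ⊕ x_1 ⊕ ⋯ ⊕ x_n⟩`. -/
def parityUnitary (n : ℕ) : Operator (Fin (n + 1)) := functionUnitary parity

end QAC

/-! Conjugating one qubit of a `CZ` gate by Hadamard gates gives a Toffoli gate, so that a layer can
contain any `CNOT` gates with disjoint supports.

In one row, the `CNOT` gates that add the two end points of an interval to their neighbours form one
layer, and conjugation with this layer reduces parity on an interval to parity on a shorter one.

A tree of block sums, followed by its inverse, computes parity of `(k + 1) ^ L` bits from `L` levels
of parities of `k + 1` bits. A layer whose gates can be drawn on `w` tracks without overlaps on a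
track is carried out in a lattice with `w + 1` rows: each qubit is copied within its column to the
row of its track, where ones let the gate pass over the qubits in between. For `k = 1` the tree
needs a single track, which gives width `2` and logarithmic depth.

For larger `k`, parity of `k + 1` bits is computed in constant depth. A register of `(8 k) ^ k`
columns of `k` qubits and one further qubit is prepared in a superposition in which the register
vanishes with probability `1 / 2` and otherwise has a column of ones; one round of amplitude
amplification makes this exact. Testing for each input `i` whether it is set and row `i` of the
register vanishes gives no phase when there is a column of ones, and the parity of the inputs as a
phase when the register vanishes. Hence odd parity sends the prepared state to an orthogonal one,
which a gate on the register detects. With `k` of order `√(log n)` the register has polynomial size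
and the tree has depth of order `log n / log log n`. -/

namespace QAC

open Matrix

section BasisVectors

variable {α β : Type*}

/-- The computational basis vector `|z⟩`. -/
abbrev ket [DecidableEq α] (z : α) : α → ℂ := Pi.single z 1

/-- The linear map with `|x⟩ ↦ |f x⟩`, as a matrix. -/
def basisMap [DecidableEq β] (f : α → β) : Matrix β α ℂ :=
  Matrix.of fun y x => if y = f x then 1 else 0

theorem basisMap_mulVec_ket [Fintype α] [DecidableEq α] [DecidableEq β] (f : α → β) (z : α) :
    basisMap f *ᵥ ket z = ket (f z) := by
  ext y
  simp [basisMap, Pi.single_apply]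

theorem basisMap_mulVec_apply [Fintype α] [DecidableEq β] {f : α → β}
    (hf : Function.Injective f) (φ : α → ℂ) (z : α) : (basisMap f *ᵥ φ) (f z) = φ z := by
  classical
  simp [basisMap, mulVec, dotProduct, hf.eq_iff]

theorem basisMap_mulVec_apply_of_ne [Fintype α] [DecidableEq β] {f : α → β} (φ : α → ℂ) {y : β}
    (hy : ∀ z, y ≠ f z) : (basisMap f *ᵥ φ) y = 0 := by
  simp [basisMap, mulVec, dotProduct, hy]

theorem mulVec_eq_sum_ket [Fintype α] [DecidableEq α] (A : Matrix β α ℂ) (φ : α → ℂ) :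
    A *ᵥ φ = ∑ w, φ w • (A *ᵥ ket w) := by
  ext y
  simp [mulVec, dotProduct, mul_comm]

theorem mulVec_congr_of_ket [Fintype α] [DecidableEq α] {A B : Matrix β α ℂ} {φ : α → ℂ}
    (h : ∀ w, φ w ≠ 0 → A *ᵥ ket w = B *ᵥ ket w) : A *ᵥ φ = B *ᵥ φ := by
  rw [mulVec_eq_sum_ket A, mulVec_eq_sum_ket B]
  refine Finset.sum_congr rfl fun w _ => ?_
  by_cases hw : φ w = 0
  · rw [hw, zero_smul, zero_smul]
  · rw [h w hw]

theorem diagonal_mulVec_ket [Fintype α] [DecidableEq α] (d : α → ℂ) (z : α) :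
    diagonal d *ᵥ ket z = d z • ket z := by
  ext y
  by_cases h : y = z
  · subst h; simp [mulVec_diagonal]
  · simp [h]

/-- The operator `A` acts on the vectors `|f x⟩` as `B` acts on the vectors `|x⟩`. -/
def Intertwines [Fintype α] [Fintype β] [DecidableEq β] (f : α → β)
    (A : Matrix β β ℂ) (B : Matrix α α ℂ) : Prop :=
  A * basisMap f = basisMap f * B

namespace Intertwines

variable [Fintype α] [Fintype β] [DecidableEq β] {f : α → β}
  {A A' : Matrix β β ℂ} {B B' : Matrix α α ℂ}

theorem of_ket [DecidableEq α] (h : ∀ z, A *ᵥ ket (f z) = basisMap f *ᵥ (B *ᵥ ket z)) :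
    Intertwines f A B := by
  refine Matrix.ext_of_mulVec_single fun z => ?_
  rw [← mulVec_mulVec, ← mulVec_mulVec, basisMap_mulVec_ket, h]

theorem mulVec_basisMap_mulVec (h : Intertwines f A B) (φ : α → ℂ) :
    A *ᵥ (basisMap f *ᵥ φ) = basisMap f *ᵥ (B *ᵥ φ) := by
  rw [mulVec_mulVec, h, mulVec_mulVec]

theorem mul (h : Intertwines f A B) (h' : Intertwines f A' B') :
    Intertwines f (A * A') (B * B') := by
  rw [Intertwines, Matrix.mul_assoc, h', ← Matrix.mul_assoc, h, Matrix.mul_assoc]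

end Intertwines

end BasisVectors

section Circuits

variable {Q : Type} [Fintype Q]

theorem tensorUnitary_one : tensorUnitary (1 : Q → unitaryGroup Bool ℂ) = 1 := by
  ext x y
  simp only [tensorUnitary, of_apply, Pi.one_apply, OneMemClass.coe_one, one_apply,
    Finset.prod_ite_zero, Finset.prod_const_one, Finset.mem_univ, true_imp_iff, funext_iff]

theorem conjTranspose_tensorUnitary (u : Q → unitaryGroup Bool ℂ) :
    (tensorUnitary u)ᴴ = tensorUnitary (star u) := by
  ext x y
  simp [tensorUnitary]

variable [DecidableEq Q]

theorem tensorUnitary_mul (u v : Q → unitaryGroup Bool ℂ) :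
    tensorUnitary u * tensorUnitary v = tensorUnitary (u * v) := by
  ext x y
  simp only [tensorUnitary, mul_apply, of_apply, Pi.mul_apply, Submonoid.coe_mul,
    ← Finset.prod_mul_distrib]
  rw [Finset.prod_univ_sum, Fintype.piFinset_univ]

theorem tensorUnitary_mem_unitaryGroup (u : Q → unitaryGroup Bool ℂ) :
    tensorUnitary u ∈ unitaryGroup (Q → Bool) ℂ := by
  rw [mem_unitaryGroup_iff, star_eq_conjTranspose, conjTranspose_tensorUnitary, tensorUnitary_mul,
    show u * star u = 1 from funext fun q => Unitary.mul_star_self (u q), tensorUnitary_one]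

theorem tensorUnitary_mulVec_ket (u : Q → unitaryGroup Bool ℂ) (z x : Q → Bool) :
    (tensorUnitary u *ᵥ ket z) x = ∏ q, (u q : Matrix Bool Bool ℂ) (x q) (z q) := by
  simp [tensorUnitary]

/-- The sign by which the product of the `CZ` gates in `𝒢` multiplies `|x⟩`. -/
def gatePhase (𝒢 : Finset (Finset Q)) (x : Q → Bool) : ℂ :=
  ∏ S ∈ 𝒢, if ∀ q ∈ S, x q = true then -1 else 1

theorem prod_sign_mul_self {ι : Type*} (s : Finset ι) (p : ι → Prop) [DecidablePred p] :
    (∏ i ∈ s, if p i then (-1 : ℂ) else 1) * (∏ i ∈ s, if p i then (-1 : ℂ) else 1) = 1 := by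
  rw [← Finset.prod_mul_distrib]
  exact Finset.prod_eq_one fun i _ => by split_ifs <;> norm_num

theorem gatePhase_mul_self (𝒢 : Finset (Finset Q)) (x : Q → Bool) :
    gatePhase 𝒢 x * gatePhase 𝒢 x = 1 :=
  prod_sign_mul_self _ _

theorem star_gatePhase (𝒢 : Finset (Finset Q)) : star (gatePhase 𝒢) = gatePhase 𝒢 := by
  ext x
  simp [gatePhase, apply_ite]

theorem noncommProd_czGate (𝒢 : Finset (Finset Q))
    (h : (𝒢 : Set (Finset Q)).Pairwise (Function.onFun Commute czGate)) :
    𝒢.noncommProd czGate h = diagonal (gatePhase 𝒢) := by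
  induction 𝒢 using Finset.induction_on with
  | empty => simp [gatePhase, ← diagonal_one]
  | insert S 𝒢 hS ih =>
    rw [Finset.noncommProd_insert_of_notMem _ _ _ _ hS, ih, czGate, diagonal_mul_diagonal]
    congr 1 with x
    rw [gatePhase, gatePhase, Finset.prod_insert hS]

theorem Layer.operator_eq (l : Layer Q) :
    l.operator = tensorUnitary l.single * diagonal (gatePhase l.gates) :=
  congrArg _ (noncommProd_czGate _ _)

/-- The sets in `𝒢` can be the supports of the `CZ` gates of one layer of a circuit. -/
structure IsGateLayer {Q : Type} (𝒢 : Finset (Finset Q)) : Prop where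
  nonempty : ∀ S ∈ 𝒢, S.Nonempty
  pairwiseDisjoint : (𝒢 : Set (Finset Q)).PairwiseDisjoint id

theorem isGateLayer_singleton {Q : Type} {S : Finset Q} (hS : S.Nonempty) :
    IsGateLayer {S} where
  nonempty := by simpa using hS
  pairwiseDisjoint := by simp

theorem injOn_of_pairwiseDisjoint {Q κ : Type} {K : Set κ} {S : κ → Finset Q}
    (hne : ∀ k ∈ K, (S k).Nonempty) (hS : K.PairwiseDisjoint S) : K.InjOn S := fun k hk _ hl h =>
  hS.elim_finset hk hl _ (hne k hk).choose_spec (h ▸ (hne k hk).choose_spec)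

theorem isGateLayer_image {Q κ : Type} [DecidableEq Q] {K : Finset κ} {S : κ → Finset Q}
    (hne : ∀ k ∈ K, (S k).Nonempty) (hS : (K : Set κ).PairwiseDisjoint S) :
    IsGateLayer (K.image S) where
  nonempty := by simpa using hne
  pairwiseDisjoint := by
    rwa [Finset.coe_image, (injOn_of_pairwiseDisjoint hne hS).pairwiseDisjoint_image]

theorem gatePhase_image {κ : Type} {K : Finset κ} {S : κ → Finset Q}
    (hne : ∀ k ∈ K, (S k).Nonempty) (hS : (K : Set κ).PairwiseDisjoint S) (x : Q → Bool) :
    gatePhase (K.image S) x = ∏ k ∈ K, if ∀ q ∈ S k, x q = true then -1 else 1 :=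
  Finset.prod_image (injOn_of_pairwiseDisjoint hne hS)

/-- `Implements P d A`: the operator `A` is implemented by a circuit of depth `d` in which the
gate set of every layer satisfies `P`. -/
inductive Implements (P : Finset (Finset Q) → Prop) : ℕ → Operator Q → Prop
  | tensor (u : Q → unitaryGroup Bool ℂ) : Implements P 0 (tensorUnitary u)
  | layer {d : ℕ} {A : Operator Q} (u : Q → unitaryGroup Bool ℂ) (𝒢 : Finset (Finset Q))
      (h𝒢 : IsGateLayer 𝒢) (hP : P 𝒢) (h : Implements P d A) :
      Implements P (d + 1) (tensorUnitary u * diagonal (gatePhase 𝒢) * A)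

namespace Implements

variable {P : Finset (Finset Q) → Prop} {d e : ℕ} {A B : Operator Q}

theorem exists_circuit (h : Implements P d A) :
    ∃ C : Circuit Q, (∀ l ∈ C.layers, P l.gates) ∧ C.depth = d ∧ C.operator = A := by
  induction h with
  | tensor u => exact ⟨⟨u, []⟩, by simp, rfl, rfl⟩
  | layer u 𝒢 h𝒢 hP _ ih =>
    obtain ⟨C, hC, rfl, rfl⟩ := ih
    let l : Layer Q := ⟨𝒢, h𝒢.nonempty, fun _ hS _ hT => h𝒢.pairwiseDisjoint hS hT, u⟩
    refine ⟨⟨C.initial, C.layers ++ [l]⟩, ?_, by simp [Circuit.depth], ?_⟩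
    · simpa [or_imp, forall_and, l] using ⟨hC, hP⟩
    · simp only [Circuit.operator, List.foldl_append, List.foldl_cons, List.foldl_nil,
        Layer.operator_eq, l]

theorem tensor_mul (h : Implements P d A) (u : Q → unitaryGroup Bool ℂ) :
    Implements P d (tensorUnitary u * A) := by
  cases h with
  | tensor v => rw [tensorUnitary_mul]; exact .tensor _
  | layer v 𝒢 h𝒢 hP h =>
    rw [← Matrix.mul_assoc, ← Matrix.mul_assoc, tensorUnitary_mul]
    exact .layer _ 𝒢 h𝒢 hP h

theorem mul (hB : Implements P e B) (hA : Implements P d A) : Implements P (d + e) (B * A) := by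
  induction hB with
  | tensor u => exact hA.tensor_mul u
  | layer u 𝒢 h𝒢 hP _ ih => rw [Matrix.mul_assoc]; exact .layer u 𝒢 h𝒢 hP ih

theorem mul_tensor (h : Implements P d A) (u : Q → unitaryGroup Bool ℂ) :
    Implements P d (A * tensorUnitary u) := by
  simpa using h.mul (.tensor u)

theorem one : Implements P 0 (1 : Operator Q) := by
  rw [← tensorUnitary_one]; exact .tensor _

theorem gatePhase {𝒢 : Finset (Finset Q)} (h𝒢 : IsGateLayer 𝒢) (hP : P 𝒢) :
    Implements P 1 (diagonal (gatePhase 𝒢)) := by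
  simpa [tensorUnitary_one] using layer 1 𝒢 h𝒢 hP one

theorem congr_depth (h : Implements P d A) (hd : d = e) : Implements P e A := hd ▸ h

theorem conjTranspose (h : Implements P d A) : Implements P d Aᴴ := by
  induction h with
  | tensor u => exact conjTranspose_tensorUnitary u ▸ .tensor _
  | layer u 𝒢 h𝒢 hP _ ih =>
    rw [conjTranspose_mul, conjTranspose_mul, conjTranspose_tensorUnitary, diagonal_conjTranspose,
      star_gatePhase]
    exact (ih.mul ((gatePhase h𝒢 hP).mul_tensor _)).congr_depth (add_comm _ _)

theorem mem_unitaryGroup (h : Implements P d A) : A ∈ unitaryGroup (Q → Bool) ℂ := by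
  induction h with
  | tensor u => exact tensorUnitary_mem_unitaryGroup u
  | layer u 𝒢 _ _ _ ih =>
    refine mul_mem (mul_mem (tensorUnitary_mem_unitaryGroup u) ?_) ih
    rw [mem_unitaryGroup_iff, star_eq_conjTranspose, diagonal_conjTranspose, star_gatePhase,
      diagonal_mul_diagonal]
    simp only [gatePhase_mul_self, diagonal_one]

end Implements

end Circuits

section Gates

/-- The Hadamard gate. -/
noncomputable def hadamard : unitaryGroup Bool ℂ :=
  ⟨Matrix.of fun x y => if x && y then -(√2 : ℂ)⁻¹ else (√2 : ℂ)⁻¹, by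
    rw [mem_unitaryGroup_iff]
    ext x y
    cases x <;> cases y <;>
      simp [mul_apply, star_eq_conjTranspose, ← mul_inv, ← Complex.ofReal_mul]; norm_num⟩

/-- The gate `X ^ c`. -/
def flipGate (c : Bool) : unitaryGroup Bool ℂ :=
  ⟨Matrix.of fun x y => if x = xor y c then 1 else 0, by
    rw [mem_unitaryGroup_iff]
    ext x y
    cases x <;> cases y <;> cases c <;> simp [mul_apply, star_eq_conjTranspose]⟩

/-- The gate `Z ^ c`. -/
def signGate (c : Bool) : unitaryGroup Bool ℂ :=
  ⟨diagonal fun x => if c && x then -1 else 1, by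
    rw [mem_unitaryGroup_iff]
    ext x y
    cases x <;> cases y <;> cases c <;> simp [mul_apply, star_eq_conjTranspose]⟩

theorem hadamard_mul_signGate_mul_hadamard (c : Bool) :
    hadamard * signGate c * hadamard = flipGate c := by
  ext x y
  cases x <;> cases y <;> cases c <;>
    simp [hadamard, signGate, flipGate, mul_apply, diagonal_apply, ← mul_inv,
      ← Complex.ofReal_mul] <;> norm_num

theorem flipGate_false : flipGate false = 1 := by
  ext x y; simp [flipGate, one_apply]

theorem signGate_false : signGate false = 1 := by
  ext x y; simp [signGate]

variable {Q : Type} [Fintype Q]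

/-- The Hadamard gate on the qubits with `t q`. -/
noncomputable def hadamardOn (t : Q → Bool) : Operator Q :=
  tensorUnitary fun q => if t q then hadamard else 1

/-- The `X` gate on the qubits with `t q`. -/
def flipOn (t : Q → Bool) : Operator Q := tensorUnitary fun q => flipGate (t q)

/-- The `Z` gate on the qubits with `t q`. -/
def signOn (t : Q → Bool) : Operator Q := tensorUnitary fun q => signGate (t q)

variable [DecidableEq Q]

theorem flipOn_mulVec_ket (t z : Q → Bool) : flipOn t *ᵥ ket z = ket fun q => xor (z q) (t q) := by
  ext x
  simp only [flipOn, tensorUnitary_mulVec_ket, flipGate, of_apply, Finset.prod_ite_zero,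
    Finset.prod_const_one, Finset.mem_univ, true_imp_iff, Pi.single_apply, funext_iff]

theorem signOn_mulVec_ket (t z : Q → Bool) :
    signOn t *ᵥ ket z = (∏ q, if t q && z q then (-1 : ℂ) else 1) • ket z := by
  ext x
  rw [signOn, tensorUnitary_mulVec_ket]
  by_cases hx : x = z
  · simp [hx, signGate]
  · obtain ⟨q, hq⟩ := Function.ne_iff.1 hx
    have hzero : (signGate (t q) : Matrix Bool Bool ℂ) (x q) (z q) = 0 := by simp [signGate, hq]
    rw [Finset.prod_eq_zero (Finset.mem_univ q) hzero]
    simp [hx]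

theorem hadamardOn_mulVec_ket_apply_of_ne {t z w : Q → Bool} {q : Q} (hq : t q = false)
    (hw : w q ≠ z q) : (hadamardOn t *ᵥ ket z) w = 0 := by
  rw [hadamardOn, tensorUnitary_mulVec_ket]
  exact Finset.prod_eq_zero (Finset.mem_univ q) (by simp [hq, one_apply, hw])

theorem hadamardOn_mul_signOn_mul_hadamardOn {t c : Q → Bool}
    (hc : ∀ q, c q = true → t q = true) : hadamardOn t * signOn c * hadamardOn t = flipOn c := by
  rw [hadamardOn, signOn, tensorUnitary_mul, tensorUnitary_mul, flipOn]
  congr 1 with q : 1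
  by_cases hq : t q = true
  · simp [hq, hadamard_mul_signGate_mul_hadamard]
  · have hcq : c q = false := Bool.eq_false_iff.2 (mt (hc q) hq)
    simp [hq, hcq, flipGate_false, signGate_false]

theorem flipOn_conj_diagonal (t : Q → Bool) (φ : (Q → Bool) → ℂ) :
    flipOn t * diagonal φ * flipOn t = diagonal fun x => φ fun q => xor (x q) (t q) := by
  refine Matrix.ext_of_mulVec_single fun z => ?_
  rw [← mulVec_mulVec, flipOn_mulVec_ket, ← mulVec_mulVec, diagonal_mulVec_ket, mulVec_smul,
    flipOn_mulVec_ket, diagonal_mulVec_ket]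
  simp

theorem Implements.gatePhase_xor {P : Finset (Finset Q) → Prop} {𝒢 : Finset (Finset Q)}
    (h𝒢 : IsGateLayer 𝒢) (hP : P 𝒢) (t : Q → Bool) :
    Implements P 1 (diagonal fun x => QAC.gatePhase 𝒢 fun q => xor (x q) (t q)) := by
  rw [← flipOn_conj_diagonal]
  exact ((Implements.gatePhase h𝒢 hP).tensor_mul _).mul_tensor _

/-- Phase kickback: conjugation by Hadamard gates on the qubits with `t q` turns the signs
`(-1) ^ (c q * w q)` into flips by `c`. Only the `w` that agree with `z` off `t` matter, since
`|z⟩` is a superposition of these after the first Hadamard gates. -/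
theorem hadamardOn_conj_mulVec_ket {t c z : Q → Bool} (hc : ∀ q, c q = true → t q = true)
    {Φ : Operator Q} (hΦ : ∀ w : Q → Bool, (∀ q, t q = false → w q = z q) →
      Φ *ᵥ ket w = (∏ q, if c q && w q then (-1 : ℂ) else 1) • ket w) :
    (hadamardOn t * Φ * hadamardOn t) *ᵥ ket z = ket fun q => xor (z q) (c q) := by
  have hsign : Φ *ᵥ (hadamardOn t *ᵥ ket z) = signOn c *ᵥ (hadamardOn t *ᵥ ket z) := by
    refine mulVec_congr_of_ket fun w hw => ?_
    rw [signOn_mulVec_ket, hΦ w fun q hq => ?_]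
    by_contra hwq
    exact hw (hadamardOn_mulVec_ket_apply_of_ne hq hwq)
  rw [← mulVec_mulVec, ← mulVec_mulVec, hsign, mulVec_mulVec, mulVec_mulVec,
    hadamardOn_mul_signOn_mul_hadamardOn hc, flipOn_mulVec_ket]

end Gates

section Toffoli

variable {Q κ : Type} {K : Finset κ} {S : κ → Finset Q} {τ : κ → Q}

/-- The flips made on `|z⟩` by the Toffoli gates with supports `S k` and targets `τ k`, for
`k ∈ K`. -/
def toffoliFlip [DecidableEq Q] (K : Finset κ) (S : κ → Finset Q) (τ : κ → Q) (z : Q → Bool)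
    (q : Q) : Bool :=
  decide (∃ k ∈ K, τ k = q ∧ ∀ p ∈ S k, p ≠ q → z p = true)

theorem eq_of_target_mem (hτ : ∀ k ∈ K, τ k ∈ S k) (hS : (K : Set κ).PairwiseDisjoint S) {k l : κ}
    (hk : k ∈ K) (hl : l ∈ K) (h : τ l ∈ S k) : l = k :=
  hS.elim_finset hl hk _ (hτ l hl) h

theorem injOn_target (hτ : ∀ k ∈ K, τ k ∈ S k) (hS : (K : Set κ).PairwiseDisjoint S) :
    Set.InjOn τ K := fun _ hk l hl h => eq_of_target_mem hτ hS hl hk (h ▸ hτ l hl)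

variable [DecidableEq Q]

theorem toffoliFlip_target_iff (hτ : ∀ k ∈ K, τ k ∈ S k) (hS : (K : Set κ).PairwiseDisjoint S)
    (z : Q → Bool) {k : κ} (hk : k ∈ K) :
    toffoliFlip K S τ z (τ k) = true ↔ ∀ p ∈ S k, p ≠ τ k → z p = true := by
  refine decide_eq_true_iff.trans ⟨?_, fun h => ⟨k, hk, rfl, h⟩⟩
  rintro ⟨l, hl, hlk, h⟩
  obtain rfl := injOn_target hτ hS hl hk hlk
  exact h

theorem exists_target_of_toffoliFlip {z : Q → Bool} {q : Q} (h : toffoliFlip K S τ z q = true) :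
    ∃ k ∈ K, τ k = q :=
  let ⟨k, hk, hkq, _⟩ := of_decide_eq_true h
  ⟨k, hk, hkq⟩

variable [Fintype Q]

theorem prod_toffoliFlip (hτ : ∀ k ∈ K, τ k ∈ S k) (hS : (K : Set κ).PairwiseDisjoint S)
    {z w : Q → Bool} (hw : ∀ q, (∀ k ∈ K, τ k ≠ q) → w q = z q) :
    ∏ q, (if toffoliFlip K S τ z q && w q then (-1 : ℂ) else 1) = gatePhase (K.image S) w := by
  have hcontrol {k : κ} (hk : k ∈ K) {p : Q} (hp : p ∈ S k) (hpk : p ≠ τ k) : w p = z p := by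
    refine hw p fun l hl hlp => hpk ?_
    rw [← hlp, eq_of_target_mem hτ hS hk hl (hlp ▸ hp)]
  have hall {k : κ} (hk : k ∈ K) :
      (toffoliFlip K S τ z (τ k) && w (τ k)) = true ↔ ∀ q ∈ S k, w q = true := by
    rw [Bool.and_eq_true, toffoliFlip_target_iff hτ hS z hk]
    refine ⟨fun h p hp => ?_, fun h => ⟨fun p hp hpk => ?_, h _ (hτ k hk)⟩⟩
    · by_cases hpk : p = τ k
      · exact hpk ▸ h.2
      · rw [hcontrol hk hp hpk, h.1 p hp hpk]
    · rw [← hcontrol hk hp hpk, h p hp]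
  rw [gatePhase_image (fun k hk => ⟨_, hτ k hk⟩) hS,
    ← Finset.prod_subset (Finset.subset_univ (K.image τ)) fun q _ hq => ?_,
    Finset.prod_image (injOn_target hτ hS)]
  · exact Finset.prod_congr rfl fun k hk => by simp only [hall hk]
  · refine if_neg fun h => hq (Finset.mem_image.2 ?_)
    exact exists_target_of_toffoliFlip (Bool.and_eq_true _ _ ▸ h).1

theorem Implements.toffoli {P : Finset (Finset Q) → Prop} (hτ : ∀ k ∈ K, τ k ∈ S k)
    (hS : (K : Set κ).PairwiseDisjoint S) (hP : P (K.image S)) :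
    ∃ A, Implements P 1 A ∧
      ∀ z : Q → Bool, A *ᵥ ket z = ket fun q => xor (z q) (toffoliFlip K S τ z q) := by
  let t : Q → Bool := fun q => decide (∃ k ∈ K, τ k = q)
  refine ⟨hadamardOn t * diagonal (QAC.gatePhase (K.image S)) * hadamardOn t, ?_, fun z => ?_⟩
  · exact ((Implements.gatePhase (isGateLayer_image (fun k hk => ⟨_, hτ k hk⟩) hS) hP).tensor_mul
      _).mul_tensor _
  · refine hadamardOn_conj_mulVec_ket
      (fun q hq => decide_eq_true (exists_target_of_toffoliFlip hq)) fun w hw => ?_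
    rw [diagonal_mulVec_ket, prod_toffoliFlip hτ hS fun q hq => hw q (by simpa [t] using hq)]

end Toffoli

section Synthesis

theorem decide_odd_card_filter {ι : Type*} (s : Finset ι) (x : ι → Bool) :
    decide (Odd (s.filter fun i => x i = true).card) = ∑ i ∈ s, x i := by
  classical
  induction s using Finset.induction_on with
  | empty => simp; rfl
  | insert a s ha ih =>
    rw [Finset.sum_insert ha, ← ih, Finset.filter_insert]
    cases h : x a
    · simp [Bool.add_eq_xor]
    · rw [if_pos rfl, Finset.card_insert_of_notMem (by simp [ha])]
      simp only [Nat.odd_add_one, decide_not, Bool.add_eq_xor, Bool.true_xor]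

theorem parity_eq_sum {n : ℕ} (x : Fin n → Bool) : parity x = ∑ i, x i :=
  decide_odd_card_filter _ _

theorem functionUnitary_mulVec_ket {n : ℕ} (f : (Fin n → Bool) → Bool) (y : Fin (n + 1) → Bool) :
    functionUnitary f *ᵥ ket y = ket (Function.update y (Fin.last n)
      (xor (y (Fin.last n)) (f fun i => y i.castSucc))) := by
  ext x
  simp only [functionUnitary, mulVec_single_one, col_apply, of_apply, Pi.single_apply]

/-- The basis state of the qubits `Q` that holds the input `y` at the places `e` and `0` on the
ancilla qubits. -/
noncomputable def ancillaState {Q : Type} {k : ℕ} (e : Fin k ↪ Q) (y : Fin k → Bool) : Q → Bool :=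
  Function.extend e y fun _ => false

section

variable {Q : Type} {k : ℕ} (e : Fin k ↪ Q) (y : Fin k → Bool)

theorem ancillaState_apply (i : Fin k) : ancillaState e y (e i) = y i :=
  e.injective.extend_apply y _ i

theorem ancillaState_of_notMem {q : Q} (hq : q ∉ Set.range e) : ancillaState e y q = false :=
  Function.extend_apply' _ _ _ hq

theorem ancillaState_comp : ancillaState e y ∘ e = y := funext (ancillaState_apply e y)

theorem ancillaState_injective : Function.Injective (ancillaState e) :=
  Function.LeftInverse.injective (g := (· ∘ e)) (ancillaState_comp e)

theorem ancillaState_comp_eq {z : Q → Bool} (hz : ∀ q ∉ Set.range e, z q = false) :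
    ancillaState e (z ∘ e) = z := by
  ext q
  by_cases hq : q ∈ Set.range e
  · obtain ⟨i, rfl⟩ := hq
    exact ancillaState_apply e _ i
  · rw [hz q hq, ancillaState_of_notMem e _ hq]

theorem ancillaState_update [DecidableEq Q] (i : Fin k) (b : Bool) :
    ancillaState e (Function.update y i b) = Function.update (ancillaState e y) (e i) b := by
  rw [← ancillaState_comp_eq e (z := Function.update (ancillaState e y) (e i) b) fun q hq => ?_,
    Function.update_comp_eq_of_injective _ e.injective, ancillaState_comp]
  rw [Function.update_of_ne fun h => hq ⟨i, h.symm⟩, ancillaState_of_notMem e y hq]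

theorem withAncilla_eq [DecidableEq Q] [Fintype Q] (φ : (Fin k → Bool) → ℂ) :
    withAncilla e φ = basisMap (ancillaState e) *ᵥ φ := by
  ext z
  have hrange (q : Q) : q ∉ Finset.univ.map e ↔ q ∉ Set.range e := by simp
  simp only [withAncilla, hrange]
  split_ifs with hz
  · nth_rw 2 [← ancillaState_comp_eq e hz]
    rw [basisMap_mulVec_apply (ancillaState_injective e)]
  · rw [basisMap_mulVec_apply_of_ne]
    rintro y rfl
    exact hz fun q hq => ancillaState_of_notMem e y hq

end

variable {Q : Type} [Fintype Q] [DecidableEq Q] {n : ℕ}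

theorem Circuit.synthesizes_functionUnitary (C : Circuit Q) (e : Fin (n + 1) ↪ Q)
    (f : (Fin n → Bool) → Bool)
    (h : ∀ z : Q → Bool, (∀ q ∉ Set.range e, z q = false) →
      C.operator *ᵥ ket z = ket (Function.update z (e (Fin.last n))
        (xor (z (e (Fin.last n))) (f fun i => z (e i.castSucc))))) :
    C.Synthesizes (functionUnitary f) := by
  refine ⟨e, fun φ => ?_⟩
  rw [withAncilla_eq, withAncilla_eq]
  refine Intertwines.mulVec_basisMap_mulVec (.of_ket fun y => ?_) φ
  rw [functionUnitary_mulVec_ket, basisMap_mulVec_ket,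
    h _ fun q hq => ancillaState_of_notMem e y hq, ancillaState_update]
  simp only [ancillaState_apply]

/-- The effect on the basis states of the `CNOT` gates with controls in `s` and target `t`. -/
def addSum {Q : Type} [DecidableEq Q] (s : Finset Q) (t : Q) (z : Q → Bool) : Q → Bool :=
  Function.update z t (z t + ∑ q ∈ s, z q)

theorem addSum_eq_of_subset {Q : Type} [DecidableEq Q] {s s' : Finset Q} {t : Q} (hss' : s ⊆ s')
    (ht : t ∉ s') {z : Q → Bool} (hz : ∀ q ∉ insert t s, z q = false) :
    addSum s' t z = addSum s t z := by
  rw [addSum, addSum, Finset.sum_subset hss' fun q hq hqs => hz q ?_]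
  rw [Finset.mem_insert, not_or]
  exact ⟨ne_of_mem_of_not_mem hq ht, hqs⟩

theorem exists_placement {Q : Type} {s : Finset Q} {t : Q} (ht : t ∉ s) (hs : s.card = n) :
    ∃ e : Fin (n + 1) ↪ Q, e (Fin.last n) = t ∧ Finset.univ.map (Fin.castSuccEmb.trans e) = s := by
  let f : Fin n ≃ s := (s.equivFinOfCardEq hs).symm
  have hinj : Function.Injective (Fin.snoc (fun i => (f i : Q)) t : Fin (n + 1) → Q) :=
    Fin.snoc_injective_iff.2
      ⟨Subtype.val_injective.comp f.injective, by rintro ⟨i, rfl⟩; exact ht (f i).2⟩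
  refine ⟨⟨_, hinj⟩, by simp, ?_⟩
  ext q
  simp only [Finset.mem_map, Finset.mem_univ, true_and, Function.Embedding.trans_apply,
    Fin.coe_castSuccEmb, Function.Embedding.coeFn_mk, Fin.snoc_castSucc]
  exact ⟨by rintro ⟨i, rfl⟩; exact (f i).2, fun hq => ⟨f.symm ⟨q, hq⟩, by simp⟩⟩

theorem Circuit.synthesizes_parityUnitary {C : Circuit Q} {s : Finset Q} {t : Q} (ht : t ∉ s)
    (hs : n ≤ s.card) (h : ∀ z : Q → Bool, (∀ q ∉ insert t s, z q = false) →
      C.operator *ᵥ ket z = ket (addSum s t z)) :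
    C.Synthesizes (parityUnitary n) := by
  obtain ⟨s', hs's, hs'⟩ := Finset.exists_subset_card_eq hs
  obtain ⟨e, rfl, rfl⟩ := exists_placement (fun h => ht (hs's h)) hs'
  refine C.synthesizes_functionUnitary e parity fun z hz => ?_
  have hz' : ∀ q ∉ insert (e (Fin.last n)) (Finset.univ.map (Fin.castSuccEmb.trans e)),
      z q = false := fun q hq => hz q <| by
    rintro ⟨i, rfl⟩
    induction i using Fin.lastCases <;> simp at hq
  rw [h z fun q hq => hz' q fun hq' => hq (Finset.insert_subset_insert _ hs's hq'),
    addSum_eq_of_subset hs's ht hz', addSum, parity_eq_sum, ← Bool.add_eq_xor, Finset.sum_map]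
  rfl

end Synthesis

section Line

variable {Q : Type} [DecidableEq Q]

theorem addSum_addSum_singleton {s : Finset Q} {t c : Q} (hts : t ∉ s) (hcs : c ∉ s)
    (z : Q → Bool) : addSum s t (addSum {c} t z) = addSum (insert c s) t z := by
  simp only [addSum, Function.update_self, Function.update_idem, Finset.sum_singleton,
    Finset.sum_insert hcs, Finset.sum_update_of_notMem hts, add_assoc]

theorem addSum_conj_addSum_singleton {s : Finset Q} {t a b : Q} (hts : t ∉ s) (hbs : b ∈ s)
    (has : a ∉ s) (hat : a ≠ t) (z : Q → Bool) :
    addSum {a} b (addSum s t (addSum {a} b z)) = addSum (insert a s) t z := by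
  have hbt : b ≠ t := ne_of_mem_of_not_mem hbs hts
  have hab : a ≠ b := (ne_of_mem_of_not_mem hbs has).symm
  have hsum : ∑ q ∈ s, addSum {a} b z q = z a + ∑ q ∈ s, z q := by
    rw [addSum, Finset.sum_update_of_mem hbs, ← Finset.add_sum_erase s z hbs, Finset.sum_singleton,
      Finset.sdiff_singleton_eq_erase]
    ac_rfl
  rw [addSum, addSum, hsum, addSum]
  ext q
  rcases eq_or_ne q b with rfl | hqb
  · simp [addSum, hat, hbt, hab, Bool.add_eq_xor]
  · rcases eq_or_ne q t with rfl | hqt <;>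
      simp [addSum, *]

theorem addSum_singleton_comm {a b a' b' : Q} (hab' : a ≠ b') (ha'b : a' ≠ b) (hbb' : b ≠ b')
    (z : Q → Bool) : addSum {a} b (addSum {a'} b' z) = addSum {a'} b' (addSum {a} b z) := by
  simp only [addSum, Finset.sum_singleton, Function.update_of_ne, ne_eq, hab', ha'b, hbb',
    hbb'.symm, not_false_eq_true]
  exact Function.update_comm hbb'.symm _ _ _

theorem mem_image_Icc_erase {p : ℕ → Q} {n : ℕ} (hp : Set.InjOn p (Set.Iic n)) {i k m x : ℕ}
    (hk : k ≤ n) (hx : x ≤ n) :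
    p x ∈ ((Finset.Icc i k).erase m).image p ↔ x ≠ m ∧ i ≤ x ∧ x ≤ k := by
  rw [← Finset.mem_coe, Finset.coe_image,
    hp.mem_image_iff (fun y hy => (Finset.mem_Icc.1 (Finset.mem_of_mem_erase hy)).2.trans hk) hx,
    Finset.mem_coe, Finset.mem_erase, Finset.mem_Icc]

theorem image_Icc_erase_eq_insert_insert (p : ℕ → Q) {i k m : ℕ} (him : i < m) (hmk : m ≤ k) :
    ((Finset.Icc i (k + 1)).erase m).image p = insert (p i)
      (insert (p (k + 1)) (((Finset.Icc (i + 1) k).erase m).image p)) := by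
  rw [← Finset.image_insert, ← Finset.image_insert]
  congr 1
  ext
  simp only [Finset.mem_erase, Finset.mem_Icc, Finset.mem_insert]
  omega

variable [Fintype Q]

theorem Implements.cnot {P : Finset (Finset Q) → Prop} {a b : Q} (hab : a ≠ b)
    (hP : P {{a, b}}) :
    ∃ A, Implements P 1 A ∧ ∀ z : Q → Bool, A *ᵥ ket z = ket (addSum {a} b z) := by
  obtain ⟨A, hA, h⟩ := Implements.toffoli (P := P) (K := Finset.univ) (S := fun _ : Unit => {a, b})
    (τ := fun _ => b) (by simp) (by simp [Set.PairwiseDisjoint]) (by simpa using hP)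
  refine ⟨A, hA, fun z => ?_⟩
  rw [h]
  congr 1 with q
  by_cases hq : q = b
  · subst hq; simp [addSum, toffoliFlip, hab, Bool.add_eq_xor]
  · simp [addSum, toffoliFlip, hq, Ne.symm hq]

theorem Implements.cnot_pair {P : Finset (Finset Q) → Prop} {a b a' b' : Q} (hab : a ≠ b)
    (hab' : a' ≠ b') (hdisj : Disjoint ({a, b} : Finset Q) {a', b'})
    (hP : P {{a, b}, {a', b'}}) :
    ∃ A, Implements P 1 A ∧
      ∀ z : Q → Bool, A *ᵥ ket z = ket (addSum {a} b (addSum {a'} b' z)) := by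
  have hne : b ≠ b' ∧ a ≠ b' := by
    simp only [Finset.disjoint_insert_left, Finset.disjoint_singleton_left, Finset.mem_insert,
      Finset.mem_singleton, not_or] at hdisj
    tauto
  obtain ⟨A, hA, h⟩ := Implements.toffoli (P := P) (K := Finset.univ)
    (S := fun k => bif k then {a, b} else {a', b'}) (τ := fun k => bif k then b else b') (by simp)
    (by
      rintro (_ | _) - (_ | _) - hkl
      exacts [absurd rfl hkl, hdisj.symm, hdisj, absurd rfl hkl])
    (by simpa [Finset.image_insert, Finset.pair_comm] using hP)
  refine ⟨A, hA, fun z => ?_⟩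
  rw [h]
  congr 1 with q
  by_cases hq : q = b
  · subst hq; simp [addSum, toffoliFlip, hab, hne, hne.1.symm, Bool.add_eq_xor]
  · by_cases hq' : q = b'
    · subst hq'; simp [addSum, toffoliFlip, hq, hab', Ne.symm hq, Bool.add_eq_xor]
    · simp [addSum, toffoliFlip, hq, hq', Ne.symm hq, Ne.symm hq']

/-- Some circuit of depth `d`, all of whose gates have supports satisfying `L`, adds the qubits in
`s` to the qubit `t`. -/
def AddsInto (L : Finset Q → Prop) (s : Finset Q) (t : Q) (d : ℕ) : Prop :=
  ∃ A, Implements (fun 𝒢 => ∀ S ∈ 𝒢, L S) d A ∧ ∀ z : Q → Bool, A *ᵥ ket z = ket (addSum s t z)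

namespace AddsInto

variable {L : Finset Q → Prop} {s : Finset Q} {t a b a' b' : Q} {d : ℕ}

theorem singleton (hat : a ≠ t) (hL : L {a, t}) : AddsInto L {a} t 1 :=
  Implements.cnot hat (by simpa using hL)

theorem insert (h : AddsInto L s t d) (hts : t ∉ s) (has : a ∉ s) (hat : a ≠ t) (hL : L {a, t}) :
    AddsInto L (insert a s) t (d + 1) := by
  obtain ⟨A, hA, hAz⟩ := h
  obtain ⟨B, hB, hBz⟩ := singleton hat hL
  refine ⟨A * B, (hA.mul hB).congr_depth (add_comm _ _), fun z => ?_⟩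
  rw [← mulVec_mulVec, hBz, hAz, addSum_addSum_singleton hts has]

/-- Conjugation by the gates `a → b` and `a' → b'`, which form one layer. -/
theorem insert_insert (h : AddsInto L s t d) (hts : t ∉ s) (hbs : b ∈ s) (hbs' : b' ∈ s)
    (hbb' : b ≠ b') (has : a ∉ s) (has' : a' ∉ s) (haa' : a ≠ a') (hat : a ≠ t) (hat' : a' ≠ t)
    (hL : L {a, b}) (hL' : L {a', b'}) :
    AddsInto L (Insert.insert a (Insert.insert a' s)) t (d + 2) := by
  have hab : a ≠ b := (ne_of_mem_of_not_mem hbs has).symm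
  have hab' : a ≠ b' := (ne_of_mem_of_not_mem hbs' has).symm
  have ha'b : a' ≠ b := (ne_of_mem_of_not_mem hbs has').symm
  have ha'b' : a' ≠ b' := (ne_of_mem_of_not_mem hbs' has').symm
  obtain ⟨A, hA, hAz⟩ := h
  obtain ⟨B, hB, hBz⟩ := Implements.cnot_pair (P := fun 𝒢 => ∀ S ∈ 𝒢, L S) hab ha'b'
    (by simp [haa'.symm, hab'.symm, ha'b, hbb'.symm]) (by simpa using ⟨hL, hL'⟩)
  refine ⟨B * (A * B), (hB.mul (hA.mul hB)).congr_depth (by omega), fun z => ?_⟩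
  rw [← mulVec_mulVec, ← mulVec_mulVec, hBz, hAz, hBz, addSum_singleton_comm hab' ha'b hbb' z,
    addSum_conj_addSum_singleton hts hbs' has' hat',
    addSum_conj_addSum_singleton (by simp [hts, hat'.symm]) (by simp [hbs]) (by simp [haa', has])
      hat]

/-- As `insert_insert`, but the gate `a' → t` commutes with the rest, so that it need not be
repeated. -/
theorem insert_insert_target (h : AddsInto L s t d) (hts : t ∉ s) (hbs : b ∈ s) (has : a ∉ s)
    (has' : a' ∉ s) (haa' : a ≠ a') (hat : a ≠ t) (hat' : a' ≠ t) (hL : L {a, b})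
    (hL' : L {a', t}) : AddsInto L (Insert.insert a (Insert.insert a' s)) t (d + 2) := by
  have hab : a ≠ b := (ne_of_mem_of_not_mem hbs has).symm
  have ha'b : a' ≠ b := (ne_of_mem_of_not_mem hbs has').symm
  have hbt : b ≠ t := ne_of_mem_of_not_mem hbs hts
  obtain ⟨A, hA, hAz⟩ := h
  obtain ⟨B, hB, hBz⟩ := Implements.cnot_pair (P := fun 𝒢 => ∀ S ∈ 𝒢, L S) hab hat'
    (by simp [haa'.symm, hat.symm, ha'b, hbt.symm]) (by simpa using ⟨hL, hL'⟩)
  obtain ⟨D, hD, hDz⟩ := Implements.cnot (P := fun 𝒢 => ∀ S ∈ 𝒢, L S) hab (by simpa using hL)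
  refine ⟨D * (A * B), (hD.mul (hA.mul hB)).congr_depth (by omega), fun z => ?_⟩
  rw [← mulVec_mulVec, ← mulVec_mulVec, hBz, hAz, hDz, addSum_singleton_comm hat ha'b hbt,
    addSum_addSum_singleton hts has', addSum_conj_addSum_singleton (by simp [hts, hat'.symm])
      (by simp [hbs]) (by simp [haa', has]) hat]

/-- Along a path of qubits, the end points of an interval are added to their neighbours inside the
interval, and the rest of the interval is treated recursively, until only the neighbours of the
target `p m` remain. -/
theorem image_Icc_erase {p : ℕ → Q} {n : ℕ} (hp : Set.InjOn p (Set.Iic n))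
    (hL : ∀ i < n, L {p i, p (i + 1)}) (d : ℕ) {i k m : ℕ} (hkn : k ≤ n)
    (hk : k = i + d + 1) (hm : m = i + d / 2 + 1) :
    AddsInto L (((Finset.Icc i k).erase m).image p) (p m) (d + 1) := by
  have hne {x y : ℕ} (hx : x ≤ n) (hy : y ≤ n) (hxy : x ≠ y) : p x ≠ p y := hp.ne hx hy hxy
  have hL' {x : ℕ} (hx : x < n) : L {p (x + 1), p x} := Finset.pair_comm (p x) _ ▸ hL x hx
  induction d using Nat.strong_induction_on generalizing i k with
  | h d ih =>
    match d with
    | 0 =>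
      have hsingleton : (Finset.Icc i k).erase m = {i} := by
        ext; simp only [Finset.mem_erase, Finset.mem_Icc, Finset.mem_singleton]; omega
      obtain rfl : m = i + 1 := by omega
      rw [hsingleton, Finset.image_singleton]
      refine singleton (hne ?_ ?_ ?_) (hL i ?_)
      all_goals omega
    | 1 =>
      obtain ⟨rfl, rfl⟩ : k = i + 1 + 1 ∧ m = i + 1 := by omega
      have hempty : (Finset.Icc (i + 1) (i + 1)).erase (i + 1) = ∅ := by simp
      rw [image_Icc_erase_eq_insert_insert p (by omega) (by omega), hempty, Finset.image_empty]
      refine insert (singleton (hne ?_ ?_ ?_) (hL' ?_)) ?_ ?_ (hne ?_ ?_ ?_) (hL i ?_)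
      all_goals try refine mt Finset.mem_singleton.1 (hne ?_ ?_ ?_)
      all_goals omega
    | 2 =>
      obtain ⟨rfl, rfl⟩ : k = i + 2 + 1 ∧ m = i + 2 := by omega
      rw [image_Icc_erase_eq_insert_insert p (by omega) (by omega)]
      refine insert_insert_target (b := p (i + 1)) (ih 0 ?_ ?_ ?_ ?_) ?_ ?_ ?_ ?_
        (hne ?_ ?_ ?_) (hne ?_ ?_ ?_) (hne ?_ ?_ ?_) (hL i ?_) (hL' ?_)
      all_goals try rw [mem_image_Icc_erase hp (by omega) (by omega)]
      all_goals omega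
    | d + 3 =>
      obtain rfl : k = i + d + 3 + 1 := by omega
      rw [image_Icc_erase_eq_insert_insert p (by omega) (by omega)]
      refine insert_insert (b := p (i + 1)) (b' := p (i + d + 3)) (ih (d + 1) ?_ ?_ ?_ ?_) ?_ ?_ ?_
        (hne ?_ ?_ ?_) ?_ ?_ (hne ?_ ?_ ?_) (hne ?_ ?_ ?_) (hne ?_ ?_ ?_) (hL i ?_) (hL' ?_)
      all_goals try rw [mem_image_Icc_erase hp (by omega) (by omega)]
      all_goals omega

end AddsInto

theorem Implements.exists_circuit2D {w m d : ℕ} {A : Operator (Fin w × Fin m)}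
    (h : Implements (fun 𝒢 => ∀ S ∈ 𝒢, IsLineInterval S) d A) :
    ∃ C : Circuit2D w m, C.depth = d ∧ C.operator = A :=
  let ⟨C, hC, hd, hA⟩ := h.exists_circuit
  ⟨⟨C, hC⟩, hd, hA⟩

theorem isLineInterval_pair {m i : ℕ} (hi : i < m) :
    IsLineInterval {((0 : Fin 1), Fin.ofNat (m + 1) i), (0, Fin.ofNat (m + 1) (i + 1))} := by
  refine Or.inl ⟨0, Fin.ofNat (m + 1) i, Fin.ofNat (m + 1) (i + 1), ?_⟩
  ext ⟨a, j⟩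
  simp [Fin.ext_iff, Fin.le_def, Nat.mod_eq_of_lt (show i < m + 1 by omega),
    Nat.mod_eq_of_lt (show i + 1 < m + 1 by omega), Subsingleton.elim a 0]
  omega

theorem exists_circuit1D (n : ℕ) (hn : 1 ≤ n) :
    ∃ C : Circuit1D (n + 1), C.depth = n ∧ C.Synthesizes (parityUnitary n) := by
  obtain ⟨d, rfl⟩ := Nat.exists_eq_add_of_le' hn
  let p (i : ℕ) : Fin 1 × Fin (d + 1 + 1) := (0, Fin.ofNat _ i)
  have hp : Set.InjOn p (Set.Iic (d + 1)) := fun x hx y hy hxy => by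
    simpa [p, Fin.ext_iff, Nat.mod_eq_of_lt (Nat.lt_succ_of_le (Set.mem_Iic.1 hx)),
      Nat.mod_eq_of_lt (Nat.lt_succ_of_le (Set.mem_Iic.1 hy))] using hxy
  obtain ⟨A, hA, hAz⟩ := AddsInto.image_Icc_erase hp (fun i hi => isLineInterval_pair hi) d
    (i := 0) le_rfl (by omega) rfl
  obtain ⟨C, hd, rfl⟩ := hA.exists_circuit2D
  refine ⟨C, hd, Circuit.synthesizes_parityUnitary ?_ ?_ fun z _ => hAz z⟩
  · rw [mem_image_Icc_erase hp le_rfl (by omega)]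
    omega
  · refine ge_of_eq ?_
    rw [Finset.card_image_of_injOn (hp.mono fun i hi => (Finset.mem_Icc.1
      (Finset.mem_of_mem_erase hi)).2), Finset.card_erase_of_mem (Finset.mem_Icc.2 (by omega))]
    simp

end Line

section Lattice

variable {w m : ℕ}

/-- The smallest interval containing `S`. -/
def intervalHull (S : Finset (Fin m)) : Finset (Fin m) :=
  Finset.univ.filter fun j => (∃ i ∈ S, i ≤ j) ∧ ∃ k ∈ S, j ≤ k

theorem mem_intervalHull {S : Finset (Fin m)} {j : Fin m} :
    j ∈ intervalHull S ↔ (∃ i ∈ S, i ≤ j) ∧ ∃ k ∈ S, j ≤ k := by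
  simp [intervalHull]

theorem subset_intervalHull (S : Finset (Fin m)) : S ⊆ intervalHull S := fun i hi =>
  mem_intervalHull.2 ⟨⟨i, hi, le_rfl⟩, i, hi, le_rfl⟩

theorem intervalHull_eq_Icc {S : Finset (Fin m)} (hS : S.Nonempty) :
    intervalHull S = Finset.Icc (S.min' hS) (S.max' hS) := by
  ext j
  rw [mem_intervalHull, Finset.mem_Icc]
  exact and_congr ⟨fun ⟨i, hi, hij⟩ => (S.min'_le i hi).trans hij, fun h => ⟨_, S.min'_mem hS, h⟩⟩
    ⟨fun ⟨k, hk, hjk⟩ => hjk.trans (S.le_max' k hk), fun h => ⟨_, S.max'_mem hS, h⟩⟩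

theorem disjoint_intervalHull {S T : Finset (Fin m)} (h : ∀ i ∈ S, ∀ j ∈ T, i < j) :
    Disjoint (intervalHull S) (intervalHull T) := by
  refine Finset.disjoint_left.2 fun k hS hT => ?_
  obtain ⟨-, i, hi, hki⟩ := mem_intervalHull.1 hS
  obtain ⟨⟨j, hj, hjk⟩, -⟩ := mem_intervalHull.1 hT
  exact (h i hi j hj).not_ge (hjk.trans hki)

/-- The gates of `𝒢` can be assigned to `w` tracks such that, of two gates on the same track, one
lies entirely before the other. -/
def IsRoutable (w : ℕ) (𝒢 : Finset (Finset (Fin m))) : Prop :=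
  ∃ r : Finset (Fin m) → Fin w, ∀ S ∈ 𝒢, ∀ T ∈ 𝒢, S ≠ T → r S = r T →
    (∀ i ∈ S, ∀ j ∈ T, i < j) ∨ ∀ i ∈ S, ∀ j ∈ T, j < i

/-- The state of the lattice with `z` in row `0`, a copy of `z i` in row `ρ i` of each column `i`,
and ones elsewhere. -/
def latticeState (ρ : Fin m → Fin (w + 1)) (z : Fin m → Bool) : Fin (w + 1) × Fin m → Bool :=
  fun q => if q.1 = 0 ∨ q.1 = ρ q.2 then z q.2 else true

theorem latticeState_injective (ρ : Fin m → Fin (w + 1)) : Function.Injective (latticeState ρ) :=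
  fun z z' h => funext fun i => by simpa [latticeState] using congrFun h (0, i)

theorem toffoliFlip_column (ρ : Fin m → Fin (w + 1)) {z : Fin m → Bool}
    {y : Fin (w + 1) × Fin m → Bool} (hy₀ : ∀ i, y (0, i) = z i)
    (hy : ∀ a i, a ≠ 0 → a ≠ ρ i → y (a, i) = true) (a : Fin (w + 1)) (i : Fin m) :
    toffoliFlip (Finset.univ.filter fun i => ρ i ≠ 0) (fun i => Finset.Icc 0 (ρ i) ×ˢ {i})
      (fun i => (ρ i, i)) y (a, i) = decide (a ≠ 0 ∧ a = ρ i ∧ z i = true) := by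
  refine decide_eq_decide.2 ⟨?_, ?_⟩
  · rintro ⟨j, hj, hji, h⟩
    obtain ⟨rfl, rfl⟩ := Prod.mk.inj hji
    have hj₀ : ρ j ≠ 0 := (Finset.mem_filter.1 hj).2
    exact ⟨hj₀, rfl, hy₀ j ▸ h (0, j) (by simp) (by simpa using hj₀.symm)⟩
  · rintro ⟨ha, rfl, hz⟩
    refine ⟨i, by simpa using ha, rfl, ?_⟩
    rintro ⟨b, j⟩ hbj hne
    obtain rfl : j = i := by simpa using (Finset.mem_product.1 hbj).2
    by_cases hb : b = 0
    · rw [hb, hy₀, hz]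
    · exact hy b j hb fun h => hne (h ▸ rfl)

/-- Within each column, a Toffoli gate whose other controls are ones copies a qubit. -/
theorem exists_copyLayer (ρ : Fin m → Fin (w + 1)) :
    ∃ V W, Implements (fun 𝒢 => ∀ S ∈ 𝒢, IsLineInterval S) 1 V ∧
      Implements (fun 𝒢 => ∀ S ∈ 𝒢, IsLineInterval S) 1 W ∧ ∀ z,
      V *ᵥ ket (latticeState 0 z) = ket (latticeState ρ z) ∧
      W *ᵥ ket (latticeState ρ z) = ket (latticeState 0 z) := by
  obtain ⟨A, hA, h⟩ := Implements.toffoli (P := fun 𝒢 => ∀ S ∈ 𝒢, IsLineInterval S)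
    (K := Finset.univ.filter fun i => ρ i ≠ 0) (S := fun i => Finset.Icc 0 (ρ i) ×ˢ {i})
    (τ := fun i => (ρ i, i)) (by simp)
    (fun k _ l _ hkl => Finset.disjoint_product.2 (Or.inr (by simpa using hkl)))
    (Finset.forall_mem_image.2 fun i _ => Or.inr ⟨0, ρ i, i, rfl⟩)
  let c (q : Fin (w + 1) × Fin m) : Bool := decide (q.1 ≠ 0 ∧ q.1 = ρ q.2)
  refine ⟨flipOn c * A, A * flipOn c, hA.tensor_mul _, hA.mul_tensor _, fun z => ⟨?_, ?_⟩⟩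
  · rw [← mulVec_mulVec, h, flipOn_mulVec_ket]
    congr 1 with ⟨a, i⟩
    rw [toffoliFlip_column ρ (z := z) (by simp [latticeState])
      (by intro a i ha _; simp [latticeState, ha])]
    by_cases ha : a = 0 <;> by_cases hai : a = ρ i <;> cases hz : z i <;>
      simp [latticeState, c, *]
  · rw [← mulVec_mulVec, flipOn_mulVec_ket, h]
    congr 1 with ⟨a, i⟩
    rw [toffoliFlip_column ρ (z := z) (by simp [latticeState, c])
      (by intro a i ha hai; simp [latticeState, c, ha, hai])]
    by_cases ha : a = 0 <;> by_cases hai : a = ρ i <;> cases hz : z i <;>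
      simp [latticeState, c, *]

section

variable {𝒢 : Finset (Finset (Fin m))} {r : Finset (Fin m) → Fin w}

theorem pairwiseDisjoint_track (hr : ∀ S ∈ 𝒢, ∀ T ∈ 𝒢, S ≠ T → r S = r T →
      (∀ i ∈ S, ∀ j ∈ T, i < j) ∨ ∀ i ∈ S, ∀ j ∈ T, j < i) :
    (𝒢 : Set (Finset (Fin m))).PairwiseDisjoint fun S =>
      ({(r S).succ} : Finset (Fin (w + 1))) ×ˢ intervalHull S := by
  intro S hS T hT hST
  refine Finset.disjoint_product.2 ?_
  by_cases h : r S = r T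
  · refine Or.inr ((hr S hS T hT hST h).elim disjoint_intervalHull fun h => ?_)
    exact (disjoint_intervalHull fun i hi j hj => h j hj i hi).symm
  · exact Or.inl (by simpa using h)

theorem nonempty_track (h𝒢 : IsGateLayer 𝒢) : ∀ S ∈ 𝒢,
    (({(r S).succ} : Finset (Fin (w + 1))) ×ˢ intervalHull S).Nonempty := fun S hS =>
  (Finset.singleton_nonempty _).product ((h𝒢.nonempty S hS).mono (subset_intervalHull S))

theorem exists_row (h𝒢 : IsGateLayer 𝒢) (r : Finset (Fin m) → Fin w) :
    ∃ ρ : Fin m → Fin (w + 1), (∀ S ∈ 𝒢, ∀ i ∈ S, ρ i = (r S).succ) ∧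
      ∀ i, ρ i ≠ 0 → ∃ S ∈ 𝒢, i ∈ S := by
  have h (i : Fin m) : ∃ a : Fin (w + 1), (∀ S ∈ 𝒢, i ∈ S → a = (r S).succ) ∧
      (a ≠ 0 → ∃ S ∈ 𝒢, i ∈ S) := by
    by_cases h : ∃ S ∈ 𝒢, i ∈ S
    · obtain ⟨S, hS, hiS⟩ := h
      refine ⟨(r S).succ, fun T hT hiT => ?_, fun _ => ⟨S, hS, hiS⟩⟩
      rw [h𝒢.pairwiseDisjoint.elim_finset hS hT i hiS hiT]
    · exact ⟨0, fun S hS hiS => absurd ⟨S, hS, hiS⟩ h, fun h₀ => absurd rfl h₀⟩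
  choose ρ hρ hρ₀ using h
  exact ⟨ρ, fun S hS i => hρ i S hS, hρ₀⟩

theorem gatePhase_latticeState (h𝒢 : IsGateLayer 𝒢)
    (hr : ∀ S ∈ 𝒢, ∀ T ∈ 𝒢, S ≠ T → r S = r T →
      (∀ i ∈ S, ∀ j ∈ T, i < j) ∨ ∀ i ∈ S, ∀ j ∈ T, j < i)
    {ρ : Fin m → Fin (w + 1)} (hρ : ∀ S ∈ 𝒢, ∀ i ∈ S, ρ i = (r S).succ)
    (hρ₀ : ∀ i, ρ i ≠ 0 → ∃ S ∈ 𝒢, i ∈ S) (z : Fin m → Bool) :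
    gatePhase (𝒢.image fun S => {(r S).succ} ×ˢ intervalHull S) (latticeState ρ z) =
      gatePhase 𝒢 z := by
  rw [gatePhase_image (nonempty_track h𝒢) (pairwiseDisjoint_track hr), gatePhase]
  refine Finset.prod_congr rfl fun S hS => ?_
  congr 1
  refine propext ⟨fun h i hi => ?_, fun h q hq => ?_⟩
  · have hq := h ((r S).succ, i) (by simpa using subset_intervalHull S hi)
    simpa [latticeState, hρ S hS i hi] using hq
  · obtain ⟨a, i⟩ := q
    obtain ⟨ha, hi⟩ := Finset.mem_product.1 hq
    obtain rfl : a = (r S).succ := by simpa using ha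
    refine ite_eq_right_iff.2 fun hrow => ?_
    have hi₀ : ρ i = (r S).succ := (hrow.resolve_left (Fin.succ_ne_zero _)).symm
    obtain ⟨T, hT, hiT⟩ := hρ₀ i (hi₀ ▸ Fin.succ_ne_zero _)
    have hmem : ((r S).succ, i) ∈
        ({(r T).succ} : Finset (Fin (w + 1))) ×ˢ intervalHull T := by
      simpa [← hi₀, hρ T hT i hiT] using subset_intervalHull T hiT
    exact h i ((pairwiseDisjoint_track hr).elim_finset hS hT _ hq hmem ▸ hiT)

theorem exists_latticePhase (h𝒢 : IsGateLayer 𝒢) (hrout : IsRoutable w 𝒢) :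
    ∃ A, Implements (fun 𝒢 => ∀ S ∈ 𝒢, IsLineInterval S) 3 A ∧ ∀ z : Fin m → Bool,
      A *ᵥ ket (latticeState (0 : Fin m → Fin (w + 1)) z) =
        gatePhase 𝒢 z • ket (latticeState 0 z) := by
  obtain ⟨r, hr⟩ := hrout
  obtain ⟨ρ, hρ, hρ₀⟩ := exists_row h𝒢 r
  obtain ⟨V, W, hV, hW, h⟩ := exists_copyLayer ρ
  have hM := Implements.gatePhase (P := fun 𝒢 => ∀ S ∈ 𝒢, IsLineInterval S)
    (isGateLayer_image (nonempty_track h𝒢) (pairwiseDisjoint_track hr))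
    (Finset.forall_mem_image.2 fun S hS =>
      Or.inl ⟨_, _, _, congrArg _ (intervalHull_eq_Icc (h𝒢.nonempty S hS))⟩)
  refine ⟨_, hW.mul (hM.mul hV), fun z => ?_⟩
  rw [← mulVec_mulVec, ← mulVec_mulVec, (h z).1, diagonal_mulVec_ket, mulVec_smul, (h z).2,
    gatePhase_latticeState h𝒢 hr hρ hρ₀]

end

theorem intertwines_latticeState_tensorUnitary (w : ℕ) (u : Fin m → unitaryGroup Bool ℂ) :
    Intertwines (latticeState 0)
      (tensorUnitary fun q : Fin (w + 1) × Fin m => if q.1 = 0 then u q.2 else 1)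
      (tensorUnitary u) := by
  refine .of_ket fun z => ?_
  ext y
  rw [tensorUnitary_mulVec_ket, Fintype.prod_prod_type, Fin.prod_univ_succ]
  by_cases h : ∃ x, y = latticeState 0 x
  · obtain ⟨x, rfl⟩ := h
    rw [basisMap_mulVec_apply (latticeState_injective 0), tensorUnitary_mulVec_ket]
    simp [latticeState]
  · rw [basisMap_mulVec_apply_of_ne _ fun x hx => h ⟨x, hx⟩]
    obtain ⟨a, i, hai⟩ : ∃ (a : Fin w) (i : Fin m), y (a.succ, i) = false := by
      by_contra! hone
      refine h ⟨fun i => y (0, i), funext fun ⟨a, i⟩ => ?_⟩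
      refine Fin.cases (by simp [latticeState]) (fun b => ?_) a
      simpa [latticeState] using hone b i
    refine mul_eq_zero_of_right _ (Finset.prod_eq_zero (Finset.mem_univ a)
      (Finset.prod_eq_zero (Finset.mem_univ i) ?_))
    simp [hai, latticeState]

theorem Implements.exists_lattice {d : ℕ} {A : Operator (Fin m)}
    (h : Implements (IsRoutable w) d A) :
    ∃ A', Implements (fun 𝒢 => ∀ S ∈ 𝒢, IsLineInterval S) (3 * d) A' ∧
      Intertwines (latticeState (0 : Fin m → Fin (w + 1))) A' A := by
  induction h with
  | tensor u => exact ⟨_, .tensor _, intertwines_latticeState_tensorUnitary w u⟩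
  | layer u 𝒢 h𝒢 hP _ ih =>
    obtain ⟨A', hA', h⟩ := ih
    obtain ⟨M, hM, hMz⟩ := exists_latticePhase h𝒢 hP
    have hM' : Intertwines (latticeState 0) M (diagonal (QAC.gatePhase 𝒢)) := by
      refine .of_ket fun z => ?_
      rw [hMz, diagonal_mulVec_ket, mulVec_smul, basisMap_mulVec_ket]
    refine ⟨_, ((hM.mul hA').tensor_mul fun q => if q.1 = 0 then u q.2 else 1).congr_depth
      (by ring), ?_⟩
    rw [Matrix.mul_assoc]
    exact (intertwines_latticeState_tensorUnitary w u).mul (hM'.mul h)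

/-- The state of the lattice with `z` in row `0` and zeros in the other rows. -/
def rowState (w : ℕ) (z : Fin m → Bool) : Fin (w + 1) × Fin m → Bool :=
  fun q => if q.1 = 0 then z q.2 else false

theorem flipOn_mulVec_ket_rowState (w : ℕ) (z : Fin m → Bool) :
    flipOn (fun q : Fin (w + 1) × Fin m => decide (q.1 ≠ 0)) *ᵥ ket (rowState w z) =
      ket (latticeState 0 z) := by
  rw [flipOn_mulVec_ket]
  congr 1 with q
  by_cases hq : q.1 = 0 <;> simp [rowState, latticeState, hq]

theorem flipOn_mulVec_ket_latticeState (w : ℕ) (z : Fin m → Bool) :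
    flipOn (fun q : Fin (w + 1) × Fin m => decide (q.1 ≠ 0)) *ᵥ ket (latticeState 0 z) =
      ket (rowState w z) := by
  rw [flipOn_mulVec_ket]
  congr 1 with q
  by_cases hq : q.1 = 0 <;> simp [rowState, latticeState, hq]

theorem addSum_rowState (w : ℕ) (s : Finset (Fin m)) (t : Fin m) (z : Fin m → Bool) :
    addSum (s.map (Function.Embedding.sectR (0 : Fin (w + 1)) (Fin m))) (0, t) (rowState w z) =
      rowState w (addSum s t z) := by
  ext ⟨a, i⟩
  by_cases ha : a = 0
  · by_cases hi : i = t <;> simp [addSum, rowState, ha, hi]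
  · simp [addSum, rowState, ha]

theorem Implements.exists_circuit2D_of_routable {n d : ℕ} {A : Operator (Fin m)}
    (h : Implements (IsRoutable w) d A) {s : Finset (Fin m)} {t : Fin m} (ht : t ∉ s)
    (hs : n ≤ s.card) (hA : ∀ z : Fin m → Bool, (∀ q ∉ insert t s, z q = false) →
      A *ᵥ ket z = ket (addSum s t z)) :
    ∃ C : Circuit2D (w + 1) m, C.depth = 3 * d ∧ C.Synthesizes (parityUnitary n) := by
  obtain ⟨A', hA', hintertwines⟩ := h.exists_lattice
  let c (q : Fin (w + 1) × Fin m) : Bool := decide (q.1 ≠ 0)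
  obtain ⟨C, hd, hC⟩ := ((hA'.mul_tensor fun q => flipGate (c q)).tensor_mul
    fun q => flipGate (c q)).exists_circuit2D
  refine ⟨C, hd, Circuit.synthesizes_parityUnitary (t := (0, t))
    (s := s.map (.sectR 0 (Fin m))) (by simpa using ht) (by simpa using hs) fun z hz => ?_⟩
  obtain ⟨y, rfl, hy⟩ : ∃ y, z = rowState w y ∧ ∀ q ∉ insert t s, y q = false := by
    refine ⟨fun i => z (0, i), funext fun ⟨a, i⟩ => ?_, fun q hq => hz _ (by simpa using hq)⟩
    by_cases ha : a = 0
    · simp [rowState, ha]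
    · rw [hz _ (by simp [ha, Ne.symm ha])]
      simp [rowState, ha]
  change C.operator = flipOn c * (A' * flipOn c) at hC
  rw [hC, ← mulVec_mulVec, ← mulVec_mulVec, flipOn_mulVec_ket_rowState, ← basisMap_mulVec_ket,
    hintertwines.mulVec_basisMap_mulVec, hA y hy, basisMap_mulVec_ket,
    flipOn_mulVec_ket_latticeState, addSum_rowState]

end Lattice

section Blocks

variable {J G Q : Type}

/-- The state with `f j` on the block `ι (j, ·)`, for all `j`, and with `x` on the other qubits. -/
noncomputable def blockState (ι : J × G ↪ Q) (x : Q → Bool) (f : J → G → Bool) : Q → Bool :=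
  Function.extend ι (fun p => f p.1 p.2) x

section

variable (ι : J × G ↪ Q) (x : Q → Bool) (f : J → G → Bool)

theorem blockState_apply (j : J) (g : G) : blockState ι x f (ι (j, g)) = f j g :=
  ι.injective.extend_apply _ _ _

theorem blockState_of_notMem {q : Q} (hq : q ∉ Set.range ι) : blockState ι x f q = x q :=
  Function.extend_apply' _ _ _ hq

theorem blockState_injective : Function.Injective (blockState ι x) := fun f f' h => by
  ext j g
  rw [← blockState_apply ι x f, h, blockState_apply]

variable {ι x f}

theorem eq_blockState_iff {y : Q → Bool} : y = blockState ι x f ↔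
    (∀ q ∉ Set.range ι, y q = x q) ∧ ∀ j, (fun g => y (ι (j, g))) = f j := by
  refine ⟨?_, fun ⟨hx, hf⟩ => funext fun q => ?_⟩
  · rintro rfl
    exact ⟨fun q => blockState_of_notMem ι x f, fun j => funext (blockState_apply ι x f j)⟩
  · by_cases hq : q ∈ Set.range ι
    · obtain ⟨⟨j, g⟩, rfl⟩ := hq
      rw [blockState_apply, ← hf]
    · rw [blockState_of_notMem ι x f hq, hx q hq]

end

/-- The copies of the gates in `𝒢` on all blocks `ι (j, ·)`. -/
def blockGates [Fintype J] [DecidableEq Q] (ι : J × G ↪ Q) (𝒢 : Finset (Finset G)) :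
    Finset (Finset Q) :=
  (Finset.univ ×ˢ 𝒢).image fun s => s.2.map ((Function.Embedding.sectR s.1 G).trans ι)

theorem pairwiseDisjoint_block {K : Set (J × Finset G)} {𝒢 : Finset (Finset G)}
    (h𝒢 : (𝒢 : Set (Finset G)).PairwiseDisjoint id) (hK : ∀ s ∈ K, s.2 ∈ 𝒢) (ι : J × G ↪ Q) :
    K.PairwiseDisjoint fun s => s.2.map ((Function.Embedding.sectR s.1 G).trans ι) := by
  rintro ⟨j, S⟩ hs ⟨j', T⟩ ht hne
  refine Finset.disjoint_left.2 fun q hqS hqT => ?_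
  obtain ⟨g, hg, rfl⟩ := Finset.mem_map.1 hqS
  obtain ⟨g', hg', h⟩ := Finset.mem_map.1 hqT
  obtain ⟨rfl, rfl⟩ := Prod.mk.inj (ι.injective h)
  exact hne (congrArg _ (h𝒢.elim_finset (hK _ hs) (hK _ ht) g' hg hg'))

variable [Fintype J] [DecidableEq Q]

theorem IsGateLayer.blockGates {𝒢 : Finset (Finset G)} (h : IsGateLayer 𝒢) (ι : J × G ↪ Q) :
    IsGateLayer (blockGates ι 𝒢) :=
  isGateLayer_image (fun _ hs => (h.nonempty _ (Finset.mem_product.1 hs).2).map)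
    (pairwiseDisjoint_block h.pairwiseDisjoint (fun _ hs => (Finset.mem_product.1 hs).2) ι)

variable [Fintype G] [Fintype Q]

/-- The operator that acts as `B` on each of the blocks `ι (j, ·)`, and as the identity on the other
qubits. -/
noncomputable def blockOp (ι : J × G ↪ Q) (B : Operator G) : Operator Q :=
  Matrix.of fun x y => open scoped Classical in (if ∀ q ∉ Set.range ι, x q = y q then 1 else 0) *
    ∏ j, B (fun g => x (ι (j, g))) fun g => y (ι (j, g))

theorem blockOp_mul [DecidableEq G] (ι : J × G ↪ Q) (B B' : Operator G) :
    blockOp ι (B * B') = blockOp ι B * blockOp ι B' := by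
  classical
  ext x y
  rw [mul_apply, ← Fintype.sum_of_injective (blockState ι x) (blockState_injective ι x)
    (fun f => blockOp ι B x (blockState ι x f) * blockOp ι B' (blockState ι x f) y) _ ?_
    fun f => rfl]
  · simp only [blockOp, of_apply, mul_apply, Finset.prod_univ_sum, Fintype.piFinset_univ,
      Finset.mul_sum]
    refine Finset.sum_congr rfl fun f _ => ?_
    have hx : ∀ q ∉ Set.range ι, x q = blockState ι x f q :=
      fun q hq => (blockState_of_notMem ι x f hq).symm
    have hxy : (∀ q ∉ Set.range ι, blockState ι x f q = y q) ↔ ∀ q ∉ Set.range ι, x q = y q :=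
      forall₂_congr fun q hq => by rw [hx q hq]
    simp only [blockState_apply, if_pos hx, hxy, Finset.prod_mul_distrib]
    ring
  · intro y hy
    rw [blockOp, of_apply, if_neg, zero_mul, zero_mul]
    exact fun h => hy ⟨_, (eq_blockState_iff.2 ⟨fun q hq => (h q hq).symm, fun _ => rfl⟩).symm⟩

theorem blockOp_mulVec_ket [DecidableEq G] (ι : J × G ↪ Q) {B : Operator G} {z : Q → Bool}
    {f : J → G → Bool} (h : ∀ j, B *ᵥ ket (fun g => z (ι (j, g))) = ket (f j)) :
    blockOp ι B *ᵥ ket z = ket (blockState ι z f) := by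
  have hB (j : J) (y : G → Bool) :
      B y (fun g => z (ι (j, g))) = if y = f j then 1 else 0 := by
    simpa [mulVec_single_one, Pi.single_apply] using congrFun (h j) y
  ext y
  simp only [mulVec_single_one, col_apply, Pi.single_apply, blockOp, of_apply, hB,
    Finset.prod_ite_zero, Finset.prod_const_one, Finset.mem_univ, true_imp_iff,
    eq_blockState_iff]
  split_ifs <;> simp_all

theorem blockOp_tensorUnitary (ι : J × G ↪ Q) (u : G → unitaryGroup Bool ℂ) :
    blockOp ι (tensorUnitary u) = tensorUnitary (Function.extend ι (fun p => u p.2) 1) := by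
  ext x y
  simp only [blockOp, tensorUnitary, of_apply]
  rw [← Finset.prod_compl_mul_prod (Finset.univ.map ι), Finset.prod_map,
    Fintype.prod_prod_type]
  congr 1
  · rw [Finset.prod_congr rfl (g := fun q => if x q = y q then (1 : ℂ) else 0)]
    · simp [Finset.prod_ite_zero]
    · intro q hq
      rw [Function.extend_apply' _ _ _ (by simpa using hq)]
      simp [one_apply]
  · simp only [ι.injective.extend_apply]

theorem blockOp_diagonal (ι : J × G ↪ Q) (φ : (G → Bool) → ℂ) :
    blockOp ι (diagonal φ) = diagonal fun x => ∏ j, φ fun g => x (ι (j, g)) := by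
  ext x y
  have hxy : x = y ↔ (∀ q ∉ Set.range ι, x q = y q) ∧
      ∀ j, (fun g => x (ι (j, g))) = fun g => y (ι (j, g)) := by
    have hy := (eq_blockState_iff (ι := ι) (y := y)).2 ⟨fun _ _ => rfl, fun _ => rfl⟩
    rw [← eq_blockState_iff, ← hy]
  simp only [blockOp, of_apply, diagonal_apply, Finset.prod_ite_zero, Finset.mem_univ,
    true_imp_iff, hxy]
  split_ifs <;> simp_all

theorem blockOp_gatePhase [DecidableEq G] {𝒢 : Finset (Finset G)} (h : IsGateLayer 𝒢)
    (ι : J × G ↪ Q) :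
    blockOp ι (diagonal (gatePhase 𝒢)) = diagonal (gatePhase (blockGates ι 𝒢)) := by
  rw [blockOp_diagonal]
  congr 1 with x
  rw [blockGates, gatePhase_image (fun _ hs => (h.nonempty _ (Finset.mem_product.1 hs).2).map)
    (pairwiseDisjoint_block h.pairwiseDisjoint (fun _ hs => (Finset.mem_product.1 hs).2) ι),
    Finset.prod_product]
  simp only [Finset.forall_mem_map, gatePhase]
  rfl

theorem Implements.blockOp [DecidableEq G] {P : Finset (Finset Q) → Prop} {d : ℕ}
    {B : Operator G} {ι : J × G ↪ Q} (h : Implements (fun 𝒢 => P (blockGates ι 𝒢)) d B) :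
    Implements P d (blockOp ι B) := by
  induction h with
  | tensor u => rw [blockOp_tensorUnitary]; exact .tensor _
  | layer u 𝒢 h𝒢 hP _ ih =>
    rw [blockOp_mul, blockOp_mul, blockOp_tensorUnitary, blockOp_gatePhase h𝒢]
    exact .layer _ _ (h𝒢.blockGates ι) hP ih

end Blocks

section Tree

variable {J G Q X : Type} [DecidableEq Q]

theorem addSum_addSum_self {s : Finset Q} {t : Q} (ht : t ∉ s) (z : Q → Bool) :
    addSum s t (addSum s t z) = z := by
  simp [addSum, Finset.sum_update_of_notMem ht, Bool.add_eq_xor]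

theorem addSum_of_ne {s : Finset Q} {q t : Q} (hq : q ≠ t) (z : Q → Bool) :
    addSum s t z q = z q :=
  Function.update_of_ne hq _ _

/-- In each block `ι (j, ·)`, add the other bits to the bit at position `g₀`. -/
noncomputable def blockSum [Fintype G] [DecidableEq G] (ι : J × G ↪ Q) (g₀ : G) (z : Q → Bool) :
    Q → Bool :=
  blockState ι z fun j => addSum {g₀}ᶜ g₀ fun g => z (ι (j, g))

theorem blockSum_conj_addSum [Fintype J] [Fintype G] [DecidableEq G] (ι : J × G ↪ Q) (g₀ : G)
    {t : Q} (ht : t ∉ Set.range ι) (z : Q → Bool) :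
    blockSum ι g₀ (addSum (Finset.univ.map ((Function.Embedding.sectL J g₀).trans ι)) t
      (blockSum ι g₀ z)) = addSum (Finset.univ.map ι) t z := by
  symm
  have hι (p : J × G) : ι p ≠ t := fun h => ht ⟨p, h⟩
  refine eq_blockState_iff.2 ⟨fun q hq => ?_, fun j => ?_⟩
  · rcases eq_or_ne q t with rfl | hqt
    · simp only [addSum, Function.update_self, Finset.sum_map, blockSum,
        blockState_of_notMem ι _ _ hq, Function.Embedding.trans_apply,
        Function.Embedding.sectL_apply, blockState_apply, Fintype.sum_prod_type,
        Fintype.sum_eq_add_sum_compl g₀]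
    · simp only [addSum_of_ne hqt, blockSum, blockState_of_notMem ι _ _ hq]
  · simp only [addSum_of_ne (hι _), blockSum, blockState_apply]
    exact (addSum_addSum_self (by simp) _).symm

theorem finProdFinEquiv_lt {M k : ℕ} {p p' : Fin M} (h : p < p') (i i' : Fin k) :
    finProdFinEquiv (p, i) < finProdFinEquiv (p', i') := by
  rw [Fin.lt_def, finProdFinEquiv_apply_val, finProdFinEquiv_apply_val]
  calc (i : ℕ) + k * p < k * (p + 1) := by rw [mul_add_one, add_comm]; gcongr; exact i.isLt
    _ ≤ k * p' := Nat.mul_le_mul_left _ h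
    _ ≤ i' + k * p' := Nat.le_add_left _ _

/-- The blocks of `k` consecutive elements of a sequence in `X`. -/
def consecutiveBlocks [LinearOrder X] {M k : ℕ} (ι : Fin (M * k) ↪o X) : Fin M × Fin k ↪ X :=
  finProdFinEquiv.toEmbedding.trans ι.toEmbedding

variable [Fintype Q] [LinearOrder X]

/-- Conjugation with the block sums reduces a sum of data qubits to the sum of the first qubits of
the blocks. -/
theorem exists_tree {P : Finset (Finset Q) → Prop} {k c : ℕ} {data : X ↪ Q} {t : Q}
    (ht : t ∉ Set.range data)
    (hblock : ∀ {M : ℕ} (ι : Fin (M * (k + 1)) ↪o X), ∃ V, Implements P c V ∧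
      ∀ z : Q → Bool, (∀ q ∉ insert t (Set.range data), z q = false) → V *ᵥ ket z =
        ket (blockSum ((consecutiveBlocks ι).trans data) 0 z))
    (hbase : ∀ x, P {{data x, t}}) {L : ℕ} (ι : Fin ((k + 1) ^ L) ↪o X) :
    ∃ A, Implements P (2 * c * L + 1) A ∧
      ∀ z : Q → Bool, (∀ q ∉ insert t (Set.range data), z q = false) →
        A *ᵥ ket z = ket (addSum (Finset.univ.map (ι.toEmbedding.trans data)) t z) := by
  induction L with
  | zero =>
    obtain ⟨A, hA, hAz⟩ := Implements.cnot (fun h => ht ⟨ι 0, h⟩) (hbase (ι 0))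
    exact ⟨A, hA, fun z _ => hAz z⟩
  | succ L ih =>
    obtain ⟨V, hV, hVz⟩ := hblock (M := (k + 1) ^ L) ι
    let heads : Fin ((k + 1) ^ L) ↪o X :=
      .ofStrictMono (fun p => consecutiveBlocks (M := (k + 1) ^ L) ι (p, 0))
        fun p p' h => ι.strictMono (finProdFinEquiv_lt h 0 0)
    obtain ⟨A, hA, hAz⟩ := ih heads
    refine ⟨V * (A * V), (hV.mul (hA.mul hV)).congr_depth (by ring), fun z hz => ?_⟩
    let ι' := (consecutiveBlocks (M := (k + 1) ^ L) ι).trans data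
    have hrange : Set.range ι' ⊆ Set.range data := Set.range_comp_subset_range _ data
    have hsum (q : Q) (hq : q ∉ insert t (Set.range data)) : blockSum ι' 0 z q = false :=
      (blockState_of_notMem _ _ _ fun h => hq (Or.inr (hrange h))).trans (hz q hq)
    rw [← mulVec_mulVec, ← mulVec_mulVec, hVz z hz, hAz _ hsum, hVz]
    · refine congrArg _ ((blockSum_conj_addSum ι' 0 (fun h => ht (hrange h)) z).trans ?_)
      have huniv : Finset.univ.map ι' = Finset.univ.map (ι.toEmbedding.trans data) :=
        (Finset.map_map finProdFinEquiv.toEmbedding (ι.toEmbedding.trans data) _).symm.trans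
          (congrArg (Finset.map _) (Finset.map_univ_equiv finProdFinEquiv))
      rw [huniv]
    · intro q hq
      rw [addSum_of_ne fun h => hq (Or.inl h), hsum q hq]

theorem isRoutable_consecutiveBlocks {M k m : ℕ} (ι : Fin (M * k) ↪o Fin m) (S : Finset (Fin k)) :
    IsRoutable 1 (blockGates (consecutiveBlocks ι) {S}) := by
  refine ⟨0, fun T hT T' hT' hne _ => ?_⟩
  obtain ⟨⟨p, _⟩, hp, rfl⟩ := Finset.mem_image.1 hT
  obtain ⟨⟨p', _⟩, hp', rfl⟩ := Finset.mem_image.1 hT'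
  obtain rfl := Finset.mem_singleton.1 (Finset.mem_product.1 hp).2
  obtain rfl := Finset.mem_singleton.1 (Finset.mem_product.1 hp').2
  simp only [Finset.forall_mem_map]
  rcases lt_trichotomy p p' with h | rfl | h
  · exact Or.inl fun i _ j _ => ι.strictMono (finProdFinEquiv_lt h i j)
  · exact absurd rfl hne
  · exact Or.inr fun i _ j _ => ι.strictMono (finProdFinEquiv_lt h j i)

theorem exists_pairSums {M m : ℕ} (ι : Fin (M * (1 + 1)) ↪o Fin m) :
    ∃ V, Implements (IsRoutable 1) 1 V ∧ ∀ z : Fin m → Bool,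
      V *ᵥ ket z = ket (blockSum (consecutiveBlocks ι) 0 z) := by
  obtain ⟨B, hB, hBz⟩ := Implements.cnot (a := (1 : Fin (1 + 1))) (b := 0) (by simp)
    (P := fun 𝒢 => IsRoutable 1 (blockGates (consecutiveBlocks ι) 𝒢))
    (isRoutable_consecutiveBlocks ι {1, 0})
  exact ⟨_, hB.blockOp, fun z => blockOp_mulVec_ket _ fun j => hBz _⟩

theorem exists_circuit2D_width_two (n L : ℕ) (hn : n ≤ 2 ^ L) :
    ∃ C : Circuit2D 2 (2 ^ L + 1), C.depth = 3 * (2 * L + 1) ∧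
      C.Synthesizes (parityUnitary n) := by
  have hlast : Fin.last (2 ^ L) ∉ Set.range (Fin.castSuccEmb (n := 2 ^ L)) := by simp
  obtain ⟨A, hA, hAz⟩ := exists_tree (P := IsRoutable 1) (k := 1) (c := 1) hlast
    (fun ι => by
      obtain ⟨V, hV, hVz⟩ := exists_pairSums (ι.trans Fin.castSuccOrderEmb)
      exact ⟨V, hV, fun z _ => hVz z⟩)
    (fun x => ⟨0, fun S hS T hT hne => absurd (by simp_all) hne⟩)
    (OrderIso.refl (Fin (2 ^ L))).toOrderEmbedding
  refine hA.exists_circuit2D_of_routable (by simp) (hn.trans (by simp)) fun z hz => hAz z ?_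
  exact fun q hq => hz q fun h => hq (by simpa [-Fin.range_castSucc] using h)

end Tree

section Amplification

variable {α : Type*} [Fintype α] [DecidableEq α]

theorem sum_star_mul_self_of_mem_unitaryGroup {A : Matrix α α ℂ} (hA : A ∈ unitaryGroup α ℂ)
    (x : α) : ∑ y, star (A y x) * A y x = 1 := by
  simpa [mul_apply, star_eq_conjTranspose] using
    congrFun (congrFun ((mem_unitaryGroup_iff').1 hA) x) x

/-- The reflection `1 - 2 |o⟩⟨o|`. -/
def reflection (o : α) : Matrix α α ℂ := diagonal fun y => if y = o then -1 else 1

theorem reflection_mulVec (o : α) (φ : α → ℂ) :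
    reflection o *ᵥ φ = φ - (2 * φ o) • ket o := by
  ext y
  rw [reflection, mulVec_diagonal]
  rcases eq_or_ne y o with rfl | hy
  · simp only [↓reduceIte, neg_mul, one_mul, Pi.sub_apply, Pi.smul_apply, Pi.single_eq_same,
      smul_eq_mul, mul_one]
    ring
  · simp [hy]

/-- The reflection `1 - 2 U |o⟩⟨o| Uᴴ` in the state `U |o⟩`. -/
def columnReflection (o : α) (U : Matrix α α ℂ) : Matrix α α ℂ := U * reflection o * Uᴴ

theorem columnReflection_mulVec {U : Matrix α α ℂ} (hU : U ∈ unitaryGroup α ℂ) (o : α)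
    (φ : α → ℂ) :
    columnReflection o U *ᵥ φ = φ - (2 * ∑ y, star (U y o) * φ y) • fun y => U y o := by
  have hUU : U * Uᴴ = 1 := mem_unitaryGroup_iff.1 hU
  have hinner : (Uᴴ *ᵥ φ) o = ∑ y, star (U y o) * φ y := rfl
  rw [columnReflection, ← mulVec_mulVec, ← mulVec_mulVec, reflection_mulVec, mulVec_sub,
    mulVec_mulVec, hUU, one_mulVec, mulVec_smul, mulVec_single_one, hinner]
  rfl

/-- One round of amplitude amplification of the state `A |o⟩`, where the states `y` with
`σ y = -1` are marked. -/
def amplify (o : α) (A : Matrix α α ℂ) (σ : α → ℂ) : Matrix α α ℂ :=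
  columnReflection o A * (diagonal σ * A)

/-- If `σ` is a sign, the hypothesis says that the marked states have total weight `1 / 4`, and the
conclusion that all other states vanish. -/
theorem amplify_apply {A : Matrix α α ℂ} (hA : A ∈ unitaryGroup α ℂ) {o : α} {σ : α → ℂ}
    (hσ : ∑ y, σ y * (star (A y o) * A y o) = 1 / 2) (y : α) :
    amplify o A σ y o = (σ y - 1) * A y o := by
  have hmarked (y : α) : ((diagonal σ * A) *ᵥ ket o) y = σ y * A y o := by
    rw [mulVec_single_one, col_apply, diagonal_mul]
  calc amplify o A σ y o = (columnReflection o A *ᵥ ((diagonal σ * A) *ᵥ ket o)) y := by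
        rw [mulVec_mulVec, mulVec_single_one, col_apply, amplify]
    _ = σ y * A y o - 2 * (∑ y, σ y * (star (A y o) * A y o)) * A y o := by
        simp only [columnReflection_mulVec hA, Pi.sub_apply, Pi.smul_apply, smul_eq_mul, hmarked,
          mul_left_comm]
    _ = (σ y - 1) * A y o := by rw [hσ]; ring

/-- The phase test of the state `C |o⟩`: its entry at `(o, o)` is the expectation of `δ`. -/
def phaseTest (C : Matrix α α ℂ) (δ : α → ℂ) : Matrix α α ℂ := Cᴴ * diagonal δ * C

variable {C : Matrix α α ℂ} {δ : α → ℂ} {o : α}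

theorem phaseTest_mul_self (hC : C ∈ unitaryGroup α ℂ) (hδ : ∀ y, δ y * δ y = 1) :
    phaseTest C δ * phaseTest C δ = 1 := by
  have hCC : C * Cᴴ = 1 := mem_unitaryGroup_iff.1 hC
  have hCC' : Cᴴ * C = 1 := mem_unitaryGroup_iff'.1 hC
  calc phaseTest C δ * phaseTest C δ = Cᴴ * (diagonal δ * (C * Cᴴ) * diagonal δ) * C := by
        simp only [phaseTest, Matrix.mul_assoc]
    _ = 1 := by simp only [hCC, Matrix.mul_one, diagonal_mul_diagonal, hδ, diagonal_one, hCC']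

theorem phaseTest_mulVec_ket (hC : C ∈ unitaryGroup α ℂ) (hδ : ∀ y, C y o ≠ 0 → δ y = 1) :
    phaseTest C δ *ᵥ ket o = ket o := by
  have hfix : diagonal δ *ᵥ (C *ᵥ ket o) = C *ᵥ ket o := by
    ext y
    rw [mulVec_diagonal, mulVec_single_one, col_apply]
    rcases eq_or_ne (C y o) 0 with h | h
    · rw [h, mul_zero]
    · rw [hδ y h, one_mul]
  have hCC' : Cᴴ * C = 1 := mem_unitaryGroup_iff'.1 hC
  rw [phaseTest, ← mulVec_mulVec, ← mulVec_mulVec, hfix, mulVec_mulVec, hCC', one_mulVec]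

theorem phaseTest_apply_self_eq_zero (hC : C ∈ unitaryGroup α ℂ)
    (hCo : star (C o o) * C o o = 1 / 2) (hδ : ∀ y ≠ o, C y o ≠ 0 → δ y = 1) (hδo : δ o = -1) :
    phaseTest C δ o o = 0 := by
  have hterm (y : α) : δ y * (star (C y o) * C y o) =
      star (C y o) * C y o - if y = o then 2 * (star (C o o) * C o o) else 0 := by
    rcases eq_or_ne y o with rfl | hy
    · rw [hδo, if_pos rfl]
      ring
    · rw [if_neg hy, sub_zero]
      rcases eq_or_ne (C y o) 0 with h | h
      · simp [h]
      · rw [hδ y hy h, one_mul]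
  calc phaseTest C δ o o = ∑ y, δ y * (star (C y o) * C y o) := by
        rw [phaseTest, Matrix.mul_assoc, mul_apply]
        simp only [conjTranspose_apply, diagonal_mul, mul_left_comm]
    _ = 0 := by
        rw [Finset.sum_congr rfl fun y _ => hterm y, Finset.sum_sub_distrib,
          sum_star_mul_self_of_mem_unitaryGroup hC, Finset.sum_ite_eq' Finset.univ o,
          if_pos (Finset.mem_univ _), hCo]
        norm_num

/-- If `δ o = 1`, then the phase test fixes `|o⟩`. If `δ o = -1`, then it maps `|o⟩` to a state
orthogonal to `|o⟩`, which the reflection fixes. -/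
theorem phaseTest_conj_reflection_mulVec_ket (hC : C ∈ unitaryGroup α ℂ)
    (hCo : star (C o o) * C o o = 1 / 2) (hδ : ∀ y, δ y * δ y = 1)
    (hδC : ∀ y ≠ o, C y o ≠ 0 → δ y = 1) :
    (phaseTest C δ * reflection o * phaseTest C δ) *ᵥ ket o = -δ o • ket o := by
  rw [← mulVec_mulVec, ← mulVec_mulVec, reflection_mulVec]
  rcases mul_self_eq_one_iff.1 (hδ o) with h | h
  · have hket : ket o o = (1 : ℂ) := Pi.single_eq_same o 1
    have hfix := phaseTest_mulVec_ket hC (δ := δ) (o := o) fun y hy =>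
      (eq_or_ne y o).elim (fun hyo => hyo ▸ h) fun hyo => hδC y hyo hy
    rw [hfix, mulVec_sub, mulVec_smul, hfix, h, hket]
    module
  · have horth : (phaseTest C δ *ᵥ ket o) o = 0 := by
      rw [mulVec_single_one, col_apply, phaseTest_apply_self_eq_zero hC hCo hδC h]
    rw [horth, mul_zero, zero_smul, sub_zero, mulVec_mulVec, phaseTest_mul_self hC hδ, one_mulVec,
      h, neg_neg, one_smul]

end Amplification

section Amplitude

theorem seven_eighths_le_one_sub_pow {t : ℝ} {k : ℕ} (ht : t ≤ 2) (hkt : 8 * (k * t) ≤ 1) :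
    7 / 8 ≤ (1 - t) ^ k := by
  have hbernoulli := one_add_mul_le_pow (a := -t) (by linarith) k
  rw [← sub_eq_add_neg] at hbernoulli
  linarith

theorem one_sub_pow_le_three_quarters {x : ℝ} {N : ℕ} (hx0 : 0 ≤ x) (hx1 : x ≤ 1)
    (hNx : 1 / 3 ≤ N * x) : (1 - x) ^ N ≤ 3 / 4 := by
  have hbernoulli := one_add_mul_le_pow (a := x) (by linarith) N
  have hprod : (1 - x) ^ N * (1 + x) ^ N ≤ 1 := by
    rw [← mul_pow]
    exact pow_le_one₀ (by nlinarith) (by nlinarith)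
  have hpos : 0 ≤ (1 - x) ^ N := pow_nonneg (by linarith) N
  nlinarith

theorem eight_mul_pow_le_one {t : ℝ} {k : ℕ} (hk : k ≠ 0) (ht : 0 ≤ t) (hkt : 8 * (k * t) ≤ 1) :
    8 * t ^ k ≤ 1 := by
  have hk1 : (1 : ℝ) ≤ k := Nat.one_le_cast.2 (Nat.one_le_iff_ne_zero.2 hk)
  have ht8 : 8 * t ≤ 1 := by nlinarith
  have hpow : t ^ k ≤ t := pow_le_of_le_one ht (by linarith) hk
  linarith

theorem eight_mul_mul_one_sub_pow_le_one {t : ℝ} {k : ℕ} (hk : k ≠ 0) (ht0 : 0 ≤ t) (ht1 : t ≤ 1)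
    (hkt : 8 * (k * t) ≤ 1) : 8 * (t * (1 - t)) ^ k ≤ 1 := by
  refine le_trans ?_ (eight_mul_pow_le_one hk ht0 hkt)
  have hpow : (t * (1 - t)) ^ k ≤ t ^ k := pow_le_pow_left₀ (mul_nonneg ht0 (by linarith))
    (mul_le_of_le_one_right ht0 (by linarith)) k
  linarith

theorem one_sub_le_sq_of_seven_eighths_le {x y : ℝ} (hx : 0 ≤ x) (hy : 7 / 8 ≤ y) :
    1 - 8 * (x * y) ≤ (1 - 2 * x) ^ 2 := by
  nlinarith [mul_le_mul_of_nonneg_left hy hx, sq_nonneg x]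

theorem exists_amplitude {k : ℕ} (hk : k ≠ 0) :
    ∃ t : ℝ, 0 ≤ t ∧ 8 * (k * t) ≤ 1 ∧ (1 - 8 * (t * (1 - t)) ^ k) ^ (8 * k) ^ k = 3 / 4 := by
  have hk1 : (1 : ℝ) ≤ k := Nat.one_le_cast.2 (Nat.one_le_iff_ne_zero.2 hk)
  obtain ⟨t₁, ht₁⟩ : ∃ t₁ : ℝ, 8 * k * t₁ = 1 := ⟨(8 * k)⁻¹, mul_inv_cancel₀ (by positivity)⟩
  have ht₁0 : 0 ≤ t₁ := by nlinarith
  have ht₁8 : 8 * t₁ ≤ 1 := by nlinarith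
  have hkt₁ : 8 * (k * t₁) ≤ 1 := by linarith
  have hend : (1 - 8 * (t₁ * (1 - t₁)) ^ k) ^ (8 * k) ^ k ≤ 3 / 4 := by
    refine one_sub_pow_le_three_quarters
      (mul_nonneg (by norm_num) (pow_nonneg (mul_nonneg ht₁0 (by linarith)) k))
      (eight_mul_mul_one_sub_pow_le_one hk ht₁0 (by linarith) hkt₁) ?_
    calc (1 / 3 : ℝ) ≤ 8 * (1 - t₁) ^ k := by
          linarith [seven_eighths_le_one_sub_pow (by linarith : t₁ ≤ 2) hkt₁]
      _ = (8 * k * t₁) ^ k * (8 * (1 - t₁) ^ k) := by rw [ht₁, one_pow, one_mul]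
      _ = ((8 * k) ^ k : ℕ) * (8 * (t₁ * (1 - t₁)) ^ k) := by
        rw [mul_pow _ t₁, mul_pow t₁]; push_cast; ring
  have hstart : (1 - 8 * ((0 : ℝ) * (1 - 0)) ^ k) ^ (8 * k) ^ k = 1 := by simp [hk]
  obtain ⟨t, ht, hteq⟩ := intermediate_value_Icc' ht₁0
    (f := fun t : ℝ => (1 - 8 * (t * (1 - t)) ^ k) ^ (8 * k) ^ k) (by fun_prop)
    (show (3 / 4 : ℝ) ∈ Set.Icc _ _ from ⟨hend, by simp only [hstart]; norm_num⟩)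
  refine ⟨t, ht.1, le_trans ?_ hkt₁, hteq⟩
  have := ht.2
  gcongr

/-- The amplitudes `c` and `s` of one qubit of a column, chosen so that `(8 k) ^ k` columns together
satisfy the two requirements of the amplification. -/
theorem exists_column_amplitudes {k : ℕ} (hk : k ≠ 0) :
    ∃ c s : ℝ, c ^ 2 + s ^ 2 = 1 ∧ (1 - 8 * ((c * s) ^ k) ^ 2) ^ (8 * k) ^ k = 3 / 4 ∧
      3 / 4 ≤ ((1 - 2 * (c ^ k) ^ 2) ^ (8 * k) ^ k) ^ 2 := by
  obtain ⟨t, ht0, hkt, hteq⟩ := exists_amplitude hk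
  have hk1 : (1 : ℝ) ≤ k := Nat.one_le_cast.2 (Nat.one_le_iff_ne_zero.2 hk)
  have ht1 : t ≤ 1 := by nlinarith
  have hc : √t ^ 2 = t := Real.sq_sqrt ht0
  have hs : √(1 - t) ^ 2 = 1 - t := Real.sq_sqrt (by linarith)
  refine ⟨√t, √(1 - t), by linarith, ?_, ?_⟩
  · rw [pow_right_comm, mul_pow √t, hc, hs, hteq]
  · rw [← hteq, pow_right_comm _ _ 2, pow_right_comm _ k, hc]
    refine pow_le_pow_left₀ (sub_nonneg.2 (eight_mul_mul_one_sub_pow_le_one hk ht0 ht1 hkt)) ?_ _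
    rw [mul_pow]
    exact one_sub_le_sq_of_seven_eighths_le (pow_nonneg ht0 k)
      (seven_eighths_le_one_sub_pow (by linarith) hkt)

end Amplitude

section Columns

/-- A rotation that maps `|0⟩` to `c |0⟩ + s |1⟩`. -/
def rotation {c s : ℝ} (h : c ^ 2 + s ^ 2 = 1) : unitaryGroup Bool ℂ :=
  ⟨Matrix.of fun x y => if x = y then (c : ℂ) else if x then (s : ℂ) else -s, by
    have hcs : (c : ℂ) * c + s * s = 1 := by rw [← sq, ← sq]; exact_mod_cast h
    rw [mem_unitaryGroup_iff]
    ext x y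
    cases x <;> cases y <;> simp [mul_apply, star_eq_conjTranspose, hcs, add_comm, mul_comm]⟩

theorem rotation_apply_false {c s : ℝ} (h : c ^ 2 + s ^ 2 = 1) (b : Bool) :
    (rotation h : Matrix Bool Bool ℂ) b false = if b then (s : ℂ) else c := by
  cases b <;> simp [rotation]

theorem exists_rescaling {q w : ℝ} (hw : 0 ≤ w) (hq : 0 < q ^ 2) (hwq : w ≤ q ^ 2) :
    ∃ c s : ℝ, c ^ 2 + s ^ 2 = 1 ∧ (c * q) ^ 2 = w := by
  have hc : √(w / q ^ 2) ^ 2 = w / q ^ 2 := Real.sq_sqrt (by positivity)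
  have hs : √(1 - w / q ^ 2) ^ 2 = 1 - w / q ^ 2 :=
    Real.sq_sqrt (sub_nonneg.2 ((div_le_one hq).2 hwq))
  exact ⟨√(w / q ^ 2), √(1 - w / q ^ 2), by rw [hc, hs]; ring,
    by rw [mul_pow, hc, div_mul_cancel₀ _ hq.ne']⟩

variable {Q : Type} [Fintype Q] [DecidableEq Q]

theorem gatePhase_univ (y : Q → Bool) :
    gatePhase {Finset.univ} y = if y = fun _ => true then -1 else 1 := by
  simp [gatePhase, funext_iff]

theorem implements_reflection [Nonempty Q] (z : Q → Bool) :
    Implements (fun _ => True) 1 (reflection z) := by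
  convert Implements.gatePhase_xor (P := fun _ => True)
    (isGateLayer_singleton Finset.univ_nonempty) trivial fun q => !(z q) using 1
  simp [reflection, gatePhase_univ, funext_iff]

theorem Implements.columnReflection [Nonempty Q] {d : ℕ} {U : Operator Q}
    (h : Implements (fun _ => True) d U) (z : Q → Bool) :
    Implements (fun _ => True) (d + 1 + d) (columnReflection z U) := by
  simpa only [QAC.columnReflection, Nat.add_assoc, Matrix.mul_assoc, Nat.add_comm] using
    h.mul ((implements_reflection z).mul h.conjTranspose)

variable {c s : ℝ} (h : c ^ 2 + s ^ 2 = 1)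

/-- The reflection in the product state `(c |0⟩ + s |1⟩) ^ ⊗Q`. -/
def productReflection (Q : Type) [Fintype Q] [DecidableEq Q] : Operator Q :=
  columnReflection (fun _ => false) (tensorUnitary fun _ => rotation h)

theorem implements_productReflection [Nonempty Q] :
    Implements (fun _ => True) 1 (productReflection h Q) :=
  (Implements.tensor _).columnReflection _

theorem productReflection_apply (y : Q → Bool) :
    productReflection h Q y (fun _ => false) = ket (fun _ => false) y -
      2 * (c : ℂ) ^ Fintype.card Q * ∏ q, if y q then (s : ℂ) else c := by
  have hcolumn := congrFun (columnReflection_mulVec (tensorUnitary_mem_unitaryGroup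
    fun _ : Q => rotation h) (fun _ => false) (ket fun _ => false)) y
  rw [mulVec_single_one, col_apply] at hcolumn
  rw [productReflection, hcolumn]
  simp [Pi.single_apply, tensorUnitary, rotation_apply_false]

theorem productReflection_apply_false :
    productReflection h Q (fun _ => false) (fun _ => false) =
      ((1 - 2 * (c ^ Fintype.card Q) ^ 2 : ℝ) : ℂ) := by
  simp only [productReflection_apply, Pi.single_eq_same, Bool.false_eq_true, ↓reduceIte,
    Finset.prod_const, Finset.card_univ]
  push_cast
  ring

theorem productReflection_apply_true [Nonempty Q] :
    productReflection h Q (fun _ => true) (fun _ => false) =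
      ((-2 * (c * s) ^ Fintype.card Q : ℝ) : ℂ) := by
  have hne : (fun _ : Q => true) ≠ fun _ => false := fun h => by simp [funext_iff] at h
  simp only [productReflection_apply, Pi.single_eq_of_ne hne, ↓reduceIte, Finset.prod_const,
    Finset.card_univ, mul_pow]
  push_cast
  ring

theorem sum_gatePhase_mul_productReflection [Nonempty Q] :
    ∑ y, gatePhase {Finset.univ} y * (star (productReflection h Q y fun _ => false) *
      productReflection h Q y fun _ => false) =
        ((1 - 8 * ((c * s) ^ Fintype.card Q) ^ 2 : ℝ) : ℂ) := by
  set φ : (Q → Bool) → ℂ := fun y =>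
    star (productReflection h Q y fun _ => false) * productReflection h Q y fun _ => false with hφ
  have hsum : ∑ y, φ y = 1 := sum_star_mul_self_of_mem_unitaryGroup
    (implements_productReflection h).mem_unitaryGroup _
  have hterm (y : Q → Bool) : gatePhase {Finset.univ} y * φ y =
      φ y - if y = fun _ => true then 2 * φ fun _ => true else 0 := by
    rw [gatePhase_univ]
    split_ifs with hy
    · rw [hy]; ring
    · ring
  calc ∑ y, gatePhase {Finset.univ} y * φ y = 1 - 2 * φ fun _ => true := by
        rw [Finset.sum_congr rfl fun y _ => hterm y, Finset.sum_sub_distrib, hsum,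
          Finset.sum_ite_eq' Finset.univ, if_pos (Finset.mem_univ _)]
    _ = _ := by
        simp only [hφ, productReflection_apply_true, RCLike.star_def, Complex.conj_ofReal]
        push_cast
        ring

end Columns

section Preparation

variable {J G : Type} [Fintype J] [Fintype G] [DecidableEq G]

/-- The sign `(-1) ^ r`, where `r` is the number of columns with all bits equal to one. -/
def columnSign (y : Option (J × G) → Bool) : ℂ :=
  ∏ j, gatePhase {Finset.univ} fun g => y (some (j, g))

theorem columnSign_false [Nonempty G] : columnSign (fun _ : Option (J × G) => false) = 1 :=
  Finset.prod_eq_one fun j _ => by simp [gatePhase_univ, funext_iff]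

theorem exists_column_of_columnSign_ne_one {y : Option (J × G) → Bool} (h : columnSign y ≠ 1) :
    ∃ j, ∀ g, y (some (j, g)) = true := by
  obtain ⟨j, -, hj⟩ := Finset.exists_ne_one_of_prod_ne_one h
  rw [gatePhase_univ] at hj
  exact ⟨j, fun g => congrFun (of_not_not fun hy => hj (if_neg hy)) g⟩

variable [DecidableEq J]

theorem implements_columnSign [Nonempty G] :
    Implements (fun _ => True) 1 (diagonal (columnSign (J := J) (G := G))) := by
  have h : Implements (fun _ => True) 1 (diagonal (gatePhase {(Finset.univ : Finset G)})) :=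
    .gatePhase (isGateLayer_singleton Finset.univ_nonempty) trivial
  have hblock := h.blockOp (P := fun _ => True) (ι := (Function.Embedding.some : J × G ↪ _))
  rwa [blockOp_diagonal] at hblock

theorem sum_mul_prod_columns (φ : Bool → ℂ) (ψ : (G → Bool) → ℂ) :
    ∑ y : Option (J × G) → Bool, φ (y none) * ∏ j, ψ (fun g => y (some (j, g))) =
      (∑ b, φ b) * (∑ x, ψ x) ^ Fintype.card J := by
  have hpow : (∑ x, ψ x) ^ Fintype.card J = ∑ f : J → G → Bool, ∏ j, ψ (f j) := by
    rw [← Finset.card_univ, ← Finset.prod_const, Finset.prod_univ_sum, Fintype.piFinset_univ]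
  rw [hpow, Finset.sum_mul_sum, ← Fintype.sum_prod_type']
  exact Fintype.sum_equiv ((Equiv.piOptionEquivProd (β := fun _ : Option (J × G) => Bool)).trans
    ((Equiv.refl Bool).prodCongr (Equiv.curry J G Bool))) _ _ fun y => rfl

/-- The operator that applies `r` to the qubit `none` and `B` to every column. -/
noncomputable def columnwise (J : Type) [Fintype J] [DecidableEq J] (r : unitaryGroup Bool ℂ)
    (B : Operator G) : Operator (Option (J × G)) :=
  blockOp Function.Embedding.some B * tensorUnitary fun q => q.elim r fun _ => 1

theorem Implements.columnwise {d : ℕ} {B : Operator G} (h : Implements (fun _ => True) d B)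
    (r : unitaryGroup Bool ℂ) : Implements (fun _ => True) d (columnwise J r B) :=
  (Implements.blockOp (P := fun _ => True) h).mul_tensor _

theorem columnwise_apply (r : unitaryGroup Bool ℂ) (B : Operator G) (y : Option (J × G) → Bool) :
    columnwise J r B y (fun _ => false) = (r : Matrix Bool Bool ℂ) (y none) false *
      ∏ j, B (fun g => y (some (j, g))) fun _ => false := by
  rw [columnwise, mul_apply, Finset.sum_eq_single fun q => q.elim (y none) fun _ => false]
  · simp [blockOp, tensorUnitary, Fintype.prod_option, Option.forall, mul_comm, one_apply]
  · intro w _ hw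
    by_cases hcolumns : ∀ p, w (some p) = false
    · have hnone : y none ≠ w none := fun h =>
        hw <| funext fun q => by cases q <;> simp [h, hcolumns]
      simp [blockOp, Option.forall, hnone]
    · push Not at hcolumns
      obtain ⟨p, hp⟩ := hcolumns
      have hzero : tensorUnitary (fun q : Option (J × G) => q.elim r fun _ => 1) w
          (fun _ => false) = 0 :=
        Finset.prod_eq_zero (Finset.mem_univ (some p)) (by simp [hp])
      rw [hzero, mul_zero]
  · simp

theorem sum_columnSign_mul_columnwise (r : unitaryGroup Bool ℂ) (B : Operator G) :
    ∑ y, columnSign y * (star (columnwise J r B y fun _ => false) *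
      columnwise J r B y fun _ => false) =
        (∑ x, gatePhase {Finset.univ} x * (star (B x fun _ => false) * B x fun _ => false)) ^
          Fintype.card J := by
  have hr : ∑ b, star ((r : Matrix Bool Bool ℂ) b false) * (r : Matrix Bool Bool ℂ) b false = 1 :=
    sum_star_mul_self_of_mem_unitaryGroup r.2 false
  rw [← one_mul (_ ^ _), ← hr, ← sum_mul_prod_columns]
  refine Finset.sum_congr rfl fun y _ => ?_
  rw [columnwise_apply, star_mul', star_prod, Finset.prod_mul_distrib, Finset.prod_mul_distrib,
    columnSign]
  ring

theorem exists_preparation [Nonempty G]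
    (hJ : Fintype.card J = (8 * Fintype.card G) ^ Fintype.card G) :
    ∃ A : Operator (Option (J × G)), Implements (fun _ => True) 1 A ∧
      star (A (fun _ => false) fun _ => false) * A (fun _ => false) (fun _ => false) = 1 / 8 ∧
      ∑ y, columnSign y * (star (A y fun _ => false) * A y fun _ => false) = 3 / 4 := by
  obtain ⟨c, s, hcs, hsign, hq⟩ := exists_column_amplitudes (Fintype.card_ne_zero (α := G))
  rw [← hJ] at hsign hq
  obtain ⟨c', s', hcs', hweight⟩ :=
    exists_rescaling (w := 1 / 8) (by norm_num) (by linarith) (by linarith)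
  refine ⟨columnwise J (rotation hcs') (productReflection hcs G),
    (implements_productReflection hcs).columnwise _, ?_, ?_⟩
  · rw [columnwise_apply, rotation_apply_false, productReflection_apply_false]
    simp only [Bool.false_eq_true, if_false, Finset.prod_const, Finset.card_univ, star_mul',
      star_pow, RCLike.star_def, Complex.conj_ofReal]
    rw [← sq, ← Complex.ofReal_pow, ← Complex.ofReal_mul, ← Complex.ofReal_pow, hweight]
    norm_num
  · rw [sum_columnSign_mul_columnwise, sum_gatePhase_mul_productReflection, ← Complex.ofReal_pow,
      hsign]
    norm_num

/-- Amplifying the state of `exists_preparation` makes the columns certain to contain a full one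
unless the whole register vanishes, which happens with probability exactly `1 / 2`. -/
theorem exists_exactPreparation [Nonempty G]
    (hJ : Fintype.card J = (8 * Fintype.card G) ^ Fintype.card G) :
    ∃ C : Operator (Option (J × G)), Implements (fun _ => True) 6 C ∧
      star (C (fun _ => false) fun _ => false) * C (fun _ => false) (fun _ => false) = 1 / 2 ∧
      ∀ y ≠ fun _ => false, C y (fun _ => false) ≠ 0 → ∃ j, ∀ g, y (some (j, g)) = true := by
  obtain ⟨A, hA, hzero, hsign⟩ := exists_preparation hJ
  set o : Option (J × G) → Bool := fun _ => false
  set σ : (Option (J × G) → Bool) → ℂ := fun y => (if y = o then -1 else 1) * columnSign y with hσ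
  have hterm (y : Option (J × G) → Bool) : σ y * (star (A y o) * A y o) =
      columnSign y * (star (A y o) * A y o) - if y = o then 2 * (star (A o o) * A o o) else 0 := by
    rcases eq_or_ne y o with rfl | hy
    · simp only [hσ, o, if_true, columnSign_false]
      ring
    · simp [hσ, hy]
  have hmarked : ∑ y, σ y * (star (A y o) * A y o) = 1 / 2 := by
    rw [Finset.sum_congr rfl fun y _ => hterm y, Finset.sum_sub_distrib, hsign,
      Finset.sum_ite_eq' Finset.univ o, if_pos (Finset.mem_univ _), hzero]
    norm_num
  have hcolumn := amplify_apply hA.mem_unitaryGroup hmarked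
  refine ⟨amplify o A σ, ?_, ?_, fun y hy hC => ?_⟩
  · have hσ' : diagonal σ = reflection o * diagonal columnSign := by
      rw [reflection, diagonal_mul_diagonal]
    rw [amplify, hσ']
    exact (hA.columnReflection o).mul
      (((implements_reflection o).mul implements_columnSign).mul hA)
  · have hσo : σ o = -1 := by simp [hσ, o, columnSign_false]
    rw [hcolumn, hσo, star_mul']
    calc _ = 4 * (star (A o o) * A o o) := by norm_num; ring
      _ = 1 / 2 := by rw [hzero]; norm_num
  · refine exists_column_of_columnSign_ne_one fun h => hC ?_
    rw [hcolumn]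
    simp [hσ, hy, h]

end Preparation

section Spectators

variable {R Q : Type}

/-- The qubits in the range of `e` as a single block. -/
def singleBlock (e : R ↪ Q) : Unit × R ↪ Q := (Equiv.punitProd R).toEmbedding.trans e

variable {D : Type} [Fintype D] [DecidableEq D] [Fintype R] [DecidableEq R]

theorem intertwines_blockOp_inr (a : D → Bool) (B : Operator R) :
    Intertwines (Sum.elim a) (blockOp (singleBlock Function.Embedding.inr) B) B := by
  have hinj : Function.Injective (Sum.elim a : (R → Bool) → D ⊕ R → Bool) :=
    fun _ _ h => funext fun r => congrFun h (Sum.inr r)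
  refine .of_ket fun z => funext fun y => ?_
  rw [mulVec_single_one, col_apply]
  by_cases hy : ∃ x, y = Sum.elim a x
  · obtain ⟨x, rfl⟩ := hy
    rw [basisMap_mulVec_apply hinj, mulVec_single_one, col_apply]
    simp [blockOp, singleBlock, Sum.forall]
  · have hleft : ¬ ∀ q, y (Sum.inl q) = a q := fun h =>
      hy ⟨fun r => y (Sum.inr r), funext fun q => by cases q <;> simp [h]⟩
    rw [basisMap_mulVec_apply_of_ne _ fun x hx => hy ⟨x, hx⟩]
    simp [blockOp, singleBlock, Sum.forall, hleft]

theorem intertwines_diagonal (a : D → Bool) (φ : (D ⊕ R → Bool) → ℂ) :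
    Intertwines (Sum.elim a) (diagonal φ) (diagonal fun r => φ (Sum.elim a r)) :=
  .of_ket fun z => by
    rw [diagonal_mulVec_ket, diagonal_mulVec_ket, mulVec_smul, basisMap_mulVec_ket]

end Spectators

section Gadget

variable {J : Type} {k : ℕ}

/-- The qubits of the parity gadget: the target `inl 0`, the inputs `inl i.succ`, and a register of
one qubit and the columns `J`, with one row for every input. -/
abbrev GadgetQubits (J : Type) (k : ℕ) : Type := Fin (k + 1) ⊕ Option (J × Fin k)

/-- The sign of the layer that tests for each input whether it is set and its row is zero. -/
def rowSign [Fintype J] (w : GadgetQubits J k → Bool) : ℂ :=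
  ∏ i : Fin k, if w (Sum.inl i.succ) = true ∧ ∀ j, w (Sum.inr (some (j, i))) = false then -1 else 1

/-- The sign of the gate that tests whether the target is set and the register is zero. -/
def registerSign [Fintype J] (w : GadgetQubits J k → Bool) : ℂ :=
  if w (Sum.inl 0) = true ∧ ∀ r, w (Sum.inr r) = false then -1 else 1

variable [Fintype J]

theorem rowSign_elim_false (a : Fin (k + 1) → Bool) :
    rowSign (Sum.elim a fun _ : Option (J × Fin k) => false) =
      if ∑ i : Fin k, a i.succ then -1 else 1 := by
  have hprod (s : Finset (Fin k)) : (∏ i ∈ s, if a i.succ = true then (-1 : ℂ) else 1) =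
      if ∑ i ∈ s, a i.succ then -1 else 1 := by
    induction s using Finset.induction_on with
    | empty => simp
    | insert i s hi ih =>
      rw [Finset.prod_insert hi, Finset.sum_insert hi, ih, Bool.add_eq_xor]
      cases a i.succ <;> cases ∑ i ∈ s, a i.succ <;> simp
  simp [rowSign, hprod]

theorem rowSign_eq_one_of_column {w : GadgetQubits J k → Bool} {j : J}
    (hj : ∀ i, w (Sum.inr (some (j, i))) = true) : rowSign w = 1 :=
  Finset.prod_eq_one fun i _ => if_neg fun h => by simpa [hj] using h.2 j

variable [DecidableEq J]

theorem implements_rowSign :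
    Implements (fun _ => True) 1 (diagonal (rowSign (J := J) (k := k))) := by
  let S (i : Fin k) : Finset (GadgetQubits J k) :=
    insert (Sum.inl i.succ) (Finset.univ.image fun j => Sum.inr (some (j, i)))
  have hne : ∀ i ∈ Finset.univ, (S i).Nonempty := fun i _ => Finset.insert_nonempty _ _
  have hS : ((Finset.univ : Finset (Fin k)) : Set (Fin k)).PairwiseDisjoint S := by
    intro i _ j _ hij
    simp only [Function.onFun, Finset.disjoint_left, S]
    rintro (q | _ | ⟨l, q⟩) hq hq' <;> simp_all
  have hdiag : rowSign (J := J) = fun w => gatePhase (Finset.univ.image S)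
      fun q => xor (w q) (Sum.elim (fun _ => false) (fun _ => true) q) := by
    funext w
    rw [gatePhase_image hne hS, rowSign]
    simp [S]
  exact hdiag ▸ Implements.gatePhase_xor (isGateLayer_image hne hS) trivial _

theorem implements_registerSign :
    Implements (fun _ => True) 1 (diagonal (registerSign (J := J) (k := k))) := by
  let S : Finset (GadgetQubits J k) := insert (Sum.inl 0) (Finset.univ.image Sum.inr)
  have hdiag : registerSign (J := J) = fun w => gatePhase {S}
      fun q => xor (w q) (Sum.elim (fun _ => false) (fun _ => true) q) := by
    funext w
    rw [gatePhase, Finset.prod_singleton, registerSign]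
    congr 1
    simp [S]
  exact hdiag ▸ Implements.gatePhase_xor
    (isGateLayer_singleton (Finset.insert_nonempty _ _)) trivial _

theorem intertwines_registerSign (a : Fin (k + 1) → Bool) :
    Intertwines (Sum.elim a) (diagonal (registerSign (J := J)))
      (if a 0 then reflection fun _ => false else 1) := by
  convert intertwines_diagonal a (registerSign (J := J)) using 1
  cases h : a 0
  · simp [registerSign, h]
  · simp [registerSign, h, reflection, funext_iff]

/-- The row test of a register that `C` prepares: computes the phase test of `C` for the signs
`rowSign` of the inputs. -/
noncomputable def rowTest (C : Operator (Option (J × Fin k))) : Operator (GadgetQubits J k) :=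
  blockOp (singleBlock Function.Embedding.inr) Cᴴ * diagonal rowSign *
    blockOp (singleBlock Function.Embedding.inr) C

theorem Implements.rowTest {d : ℕ} {C : Operator (Option (J × Fin k))}
    (hC : Implements (fun _ => True) d C) :
    Implements (fun _ => True) (d + 1 + d) (rowTest C) := by
  have hblock {B : Operator (Option (J × Fin k))} (hB : Implements (fun _ => True) d B) :
      Implements (Q := GadgetQubits J k) (fun _ => True) d
        (QAC.blockOp (singleBlock Function.Embedding.inr) B) :=
    .blockOp (P := fun _ => True) hB
  exact ((hblock hC.conjTranspose).mul implements_rowSign).mul (hblock hC) |>.congr_depth (by ring)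

theorem intertwines_rowTest (C : Operator (Option (J × Fin k))) (a : Fin (k + 1) → Bool) :
    Intertwines (Sum.elim a) (rowTest C) (phaseTest C fun r => rowSign (Sum.elim a r)) :=
  ((intertwines_blockOp_inr a _).mul (intertwines_diagonal a _)).mul (intertwines_blockOp_inr a _)

theorem rowTest_conj_registerSign_mulVec_ket {C : Operator (Option (J × Fin k))}
    (hC : C ∈ unitaryGroup _ ℂ)
    (hCo : star (C (fun _ => false) fun _ => false) * C (fun _ => false) (fun _ => false) = 1 / 2)
    (hcolumn : ∀ y ≠ fun _ => false, C y (fun _ => false) ≠ 0 → ∃ j, ∀ i, y (some (j, i)) = true)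
    (a : Fin (k + 1) → Bool) :
    (rowTest C * diagonal registerSign * rowTest C) *ᵥ ket (Sum.elim a fun _ => false) =
      (if a 0 then -(if ∑ i : Fin k, a i.succ then -1 else 1) else 1 : ℂ) •
        ket (Sum.elim a fun _ => false) := by
  have hsquare (y : Option (J × Fin k) → Bool) :
      rowSign (Sum.elim a y) * rowSign (Sum.elim a y) = 1 := prod_sign_mul_self _ _
  have htest := intertwines_rowTest C a
  rw [← basisMap_mulVec_ket,
    ((htest.mul (intertwines_registerSign a)).mul htest).mulVec_basisMap_mulVec, ← mulVec_smul,
    ← rowSign_elim_false (J := J)]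
  congr 1
  cases a 0
  · simp only [Bool.false_eq_true, if_false, Matrix.mul_one, one_smul, one_mulVec,
      phaseTest_mul_self hC hsquare]
  · simpa using phaseTest_conj_reflection_mulVec_ket hC hCo hsquare fun y hy hCy =>
      (hcolumn y hy hCy).elim fun j hj => rowSign_eq_one_of_column hj

theorem prod_sign_single {Q : Type} [Fintype Q] [DecidableEq Q] (p : Q) (b : Bool) (w : Q → Bool) :
    (∏ q, if (decide (q = p) && b) && w q then (-1 : ℂ) else 1) = if b && w p then -1 else 1 := by
  rw [Finset.prod_eq_single p] <;> simp +contextual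

theorem exists_parityPhase [NeZero k] (hJ : Fintype.card J = (8 * k) ^ k) :
    ∃ Φ : Operator (GadgetQubits J k), Implements (fun _ => True) 27 Φ ∧
      ∀ a : Fin (k + 1) → Bool, Φ *ᵥ ket (Sum.elim a fun _ => false) =
        (if (∑ i : Fin k, a i.succ) && a 0 then -1 else 1 : ℂ) •
          ket (Sum.elim a fun _ => false) := by
  obtain ⟨C, hC, hCo, hcolumn⟩ := exists_exactPreparation (G := Fin k) (by simpa using hJ)
  refine ⟨signOn (fun q => decide (q = Sum.inl 0) && true) *
    (rowTest C * diagonal registerSign * rowTest C),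
    ((hC.rowTest.mul implements_registerSign).mul hC.rowTest).tensor_mul _, fun a => ?_⟩
  rw [← mulVec_mulVec, rowTest_conj_registerSign_mulVec_ket hC.mem_unitaryGroup hCo hcolumn,
    mulVec_smul, signOn_mulVec_ket, prod_sign_single, smul_smul]
  cases h : a 0 <;> cases ∑ i : Fin k, a i.succ <;> simp [h]

theorem exists_parityGadget [NeZero k] (hJ : Fintype.card J = (8 * k) ^ k) :
    ∃ A : Operator (GadgetQubits J k), Implements (fun _ => True) 27 A ∧
      ∀ a : Fin (k + 1) → Bool, A *ᵥ ket (Sum.elim a fun _ => false) =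
        ket (Sum.elim (addSum {0}ᶜ 0 a) fun _ => false) := by
  obtain ⟨Φ, hΦ, hphase⟩ := exists_parityPhase hJ
  let t (q : GadgetQubits J k) : Bool := decide (q = Sum.inl 0)
  refine ⟨hadamardOn t * Φ * hadamardOn t, (hΦ.tensor_mul _).mul_tensor _, fun a => ?_⟩
  rw [hadamardOn_conj_mulVec_ket (c := fun q => t q && ∑ i : Fin k, a i.succ)
    fun q hq => (Bool.and_eq_true_iff.1 hq).1]
  · have hsum : ∑ q ∈ {0}ᶜ, a q = ∑ i : Fin k, a i.succ := by
      rw [← Fin.image_succ_univ, Finset.sum_image fun _ _ _ _ h => Fin.succ_injective _ h]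
    congr 1
    funext q
    rcases q with q | q
    · rcases eq_or_ne q 0 with rfl | hq
      · simp [t, addSum, hsum, Bool.add_eq_xor]
      · simp [t, addSum, hq]
    · simp [t]
  · intro w hw
    obtain ⟨b, rfl⟩ : ∃ b, w = Sum.elim (Function.update a 0 b) fun _ => false := by
      refine ⟨w (Sum.inl 0), funext fun q => ?_⟩
      by_cases hq : q = Sum.inl 0
      · simp [hq]
      · rw [hw q (by simp [t, hq])]
        rcases q with q | q
        · simp_all
        · rfl
    rw [hphase, prod_sign_single]
    simp only [Function.update_self, Function.update_of_ne (Fin.succ_ne_zero _), Sum.elim_inl]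

end Gadget

section Assembly

theorem IsGateLayer.isRoutable {m : ℕ} [NeZero m] {𝒢 : Finset (Finset (Fin m))}
    (h : IsGateLayer 𝒢) : IsRoutable m 𝒢 := by
  have hr (S : Finset (Fin m)) : ∃ i, S ∈ 𝒢 → i ∈ S := by
    by_cases hS : S ∈ 𝒢
    · exact (h.nonempty S hS).imp fun _ hi _ => hi
    · exact ⟨0, fun h => absurd h hS⟩
  choose r hr using hr
  exact ⟨r, fun S hS T hT hne hST => absurd (hST ▸ hr T hT)
    (Finset.disjoint_left.1 (h.pairwiseDisjoint hS hT hne) (hr S hS))⟩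

theorem Implements.isRoutable {m d : ℕ} [NeZero m] {A : Operator (Fin m)}
    (h : Implements (fun _ => True) d A) : Implements (IsRoutable m) d A := by
  induction h with
  | tensor u => exact .tensor u
  | layer u 𝒢 h𝒢 _ _ ih => exact .layer u 𝒢 h𝒢 h𝒢.isRoutable ih

theorem Implements.exists_circuit2D_card {Q : Type} [Fintype Q] [DecidableEq Q] {n d : ℕ}
    {A : Operator Q} (h : Implements (fun _ => True) d A) {s : Finset Q} {t : Q} (ht : t ∉ s)
    (hs : n ≤ s.card) (hA : ∀ z : Q → Bool, (∀ q ∉ insert t s, z q = false) →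
      A *ᵥ ket z = ket (addSum s t z)) :
    ∃ C : Circuit2D (Fintype.card Q + 1) (Fintype.card Q),
      C.depth = 3 * d ∧ C.Synthesizes (parityUnitary n) := by
  have : Nonempty Q := ⟨t⟩
  have : NeZero (Fintype.card Q) := ⟨Fintype.card_ne_zero⟩
  let E : Q ↪ Fin (Fintype.card Q) := (Fintype.equivFin Q).toEmbedding
  have hE : Function.Surjective E := (Fintype.equivFin Q).surjective
  refine (Implements.blockOp (P := fun _ => True) (ι := singleBlock E) h).isRoutable
    |>.exists_circuit2D_of_routable (s := s.map E) (t := E t) (by simpa) (by simpa)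
    fun z hz => ?_
  rw [blockOp_mulVec_ket (singleBlock E) fun _ => hA (fun q => z (E q)) fun q hq => hz _ ?_]
  · refine congrArg ket (eq_blockState_iff.2 ⟨fun q hq => ?_, fun _ => funext fun q => ?_⟩).symm
    · obtain ⟨q, rfl⟩ := hE q
      exact absurd ⟨((), q), rfl⟩ hq
    · change addSum (s.map E) (E t) z (E q) = _
      simp only [addSum, Finset.sum_map, Function.update_apply, E.apply_eq_iff_eq]
  · simpa using hq

/-- The qubits of a tree of parity gadgets: `(k + 1) ^ L` data qubits and a target, the qubits
`(i, none)`, each with a register of its own for the case that it is the target of a gadget. -/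
abbrev TreeQubits (J : Type) (k L : ℕ) : Type :=
  Fin ((k + 1) ^ L + 1) × Option (Option (J × Fin k))

variable {J : Type} {k L : ℕ}

/-- The data qubits of a tree of parity gadgets. -/
def treeData (J : Type) (k L : ℕ) : Fin ((k + 1) ^ L) ↪ TreeQubits J k L :=
  Fin.castSuccEmb.trans (Function.Embedding.sectL _ none)

/-- The placement of disjoint parity gadgets on blocks of data qubits, each of them using the
register of its first data qubit. -/
def gadgetBlocks {M : ℕ} (β : Fin M × Fin (k + 1) ↪ Fin ((k + 1) ^ L)) :
    Fin M × GadgetQubits J k ↪ TreeQubits J k L where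
  toFun p := p.2.elim (fun i => treeData J k L (β (p.1, i)))
    fun r => ((β (p.1, 0)).castSucc, some r)
  inj' := by
    rintro ⟨p, i | r⟩ ⟨p', i' | r'⟩ h
    · simpa using h
    · simp [treeData] at h
    · simp [treeData] at h
    · simpa using h

theorem exists_gadgetSums [Fintype J] [DecidableEq J] [NeZero k]
    (hJ : Fintype.card J = (8 * k) ^ k) {M : ℕ} (β : Fin M × Fin (k + 1) ↪ Fin ((k + 1) ^ L)) :
    ∃ V, Implements (fun _ => True) 27 V ∧ ∀ z : TreeQubits J k L → Bool,
      (∀ i r, z (i, some r) = false) →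
        V *ᵥ ket z = ket (blockSum (β.trans (treeData J k L)) 0 z) := by
  obtain ⟨B, hB, hBz⟩ := exists_parityGadget hJ
  refine ⟨_, Implements.blockOp (P := fun _ => True) (ι := gadgetBlocks β) hB, fun z hz => ?_⟩
  have hregister (p : Fin M) : (fun g => z (gadgetBlocks β (p, g))) =
      Sum.elim (fun i => z (treeData J k L (β (p, i)))) fun _ => false := by
    rw [← Sum.elim_comp_inl_inr fun g => z (gadgetBlocks β (p, g))]
    exact congrArg _ (funext fun r => hz _ r)
  rw [blockOp_mulVec_ket _ fun p => (congrArg (B *ᵥ ket ·) (hregister p)).trans (hBz _)]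
  refine congrArg ket (eq_blockState_iff.2 ⟨fun q hq => ?_, fun p => funext ?_⟩).symm
  · exact blockState_of_notMem _ _ _ fun ⟨(p, i), h⟩ => hq ⟨(p, .inl i), h⟩
  · rintro (i | r)
    · exact blockState_apply (β.trans (treeData J k L)) z _ p i
    · exact (blockState_of_notMem _ _ _ fun ⟨_, h⟩ => by cases congrArg Prod.snd h).trans (hz _ r)

theorem exists_circuit2D_treeQubits [Fintype J] [NeZero k]
    (hJ : Fintype.card J = (8 * k) ^ k) {n : ℕ} (hn : n ≤ (k + 1) ^ L) :
    ∃ C : Circuit2D (Fintype.card (TreeQubits J k L) + 1) (Fintype.card (TreeQubits J k L)),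
      C.depth = 3 * (54 * L + 1) ∧ C.Synthesizes (parityUnitary n) := by
  classical
  have ht : (Fin.last ((k + 1) ^ L), none) ∉ Set.range (treeData J k L) := by
    simp [treeData]
  obtain ⟨A, hA, hAz⟩ := exists_tree (P := fun _ => True) ht
    (fun ι => by
      obtain ⟨V, hV, hVz⟩ := exists_gadgetSums hJ (consecutiveBlocks ι)
      exact ⟨V, hV, fun z hz => hVz z fun i r => hz _ (by simp [treeData])⟩)
    (fun _ => trivial) (OrderIso.refl (Fin ((k + 1) ^ L))).toOrderEmbedding
  refine hA.exists_circuit2D_card (by simpa using ht) (hn.trans (by simp)) fun z hz => hAz z ?_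
  exact fun q hq => hz q fun h => hq (by simpa using h)

theorem card_treeQubits [Fintype J] :
    Fintype.card (TreeQubits J k L) = ((k + 1) ^ L + 1) * (Fintype.card J * k + 2) := by
  simp [Fintype.card_option]

end Assembly

section Asymptotics

open Asymptotics Filter

theorem natCast_clog_le_logb_add_one (K n : ℕ) : (Nat.clog K n : ℝ) ≤ Real.logb K n + 1 := by
  rw [← Real.natCeil_logb_natCast]
  exact (Nat.ceil_lt_add_one
    (div_nonneg (Real.log_natCast_nonneg n) (Real.log_natCast_nonneg K))).le

theorem pow_clog_le {K n : ℕ} (hK : 2 ≤ K) (hn : 2 ≤ n) : K ^ Nat.clog K n ≤ K * n :=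
  calc K ^ Nat.clog K n = K * K ^ (Nat.clog K n).pred := by
        rw [← pow_succ', ← Nat.succ_eq_add_one, Nat.succ_pred_eq_of_pos (Nat.clog_pos hK hn)]
    _ ≤ K * n := Nat.mul_le_mul_left _ (Nat.pow_pred_clog_lt_self hK hn).le

theorem isBigO_pow_of_le {f : ℕ → ℕ} {a c : ℕ} (h : ∀ n, 2 ≤ n → f n ≤ a * n ^ c) :
    (fun n => (f n : ℝ)) =O[atTop] fun n : ℕ => (n : ℝ) ^ c := by
  refine IsBigO.of_bound a ?_
  filter_upwards [eventually_ge_atTop 2] with n hn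
  rw [Real.norm_of_nonneg (by positivity), Real.norm_of_nonneg (by positivity)]
  exact_mod_cast h n hn

theorem isBigO_depth {K : ℕ → ℕ} {g : ℕ → ℝ} (c : ℕ)
    (hK : (fun n => Real.logb (K n) n) =O[atTop] g) (hg : (fun _ => (1 : ℝ)) =O[atTop] g) :
    (fun n => ((3 * (c * Nat.clog (K n) n + 1) : ℕ) : ℝ)) =O[atTop] g := by
  refine (IsBigO.of_norm_le fun n => ?_).trans
    ((hK.const_mul_left (3 * c)).add (hg.const_mul_left (3 * c + 3)))
  rw [Real.norm_of_nonneg (by positivity)]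
  push_cast
  linarith [mul_le_mul_of_nonneg_left (natCast_clog_le_logb_add_one (K n) n)
    (Nat.cast_nonneg (α := ℝ) c)]

theorem eventually_one_lt_log : ∀ᶠ n : ℕ in atTop, 1 < Real.log n :=
  (Real.tendsto_log_atTop.comp tendsto_natCast_atTop_atTop).eventually_gt_atTop 1

theorem isBigO_depth_log (c : ℕ) :
    (fun n => ((3 * (c * Nat.clog 2 n + 1) : ℕ) : ℝ)) =O[atTop] fun n : ℕ => Real.log n := by
  refine isBigO_depth (K := fun _ => 2) c ?_ ?_
  · simp only [Real.logb, div_eq_inv_mul]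
    exact (isBigO_refl _ _).const_mul_left _
  · exact IsBigO.of_norm_eventuallyLE
      (eventually_one_lt_log.mono fun n hn => by simpa using hn.le)

/-- The arity of the gadgets for `n` input bits. It is of order `√(log n)`, so that the
`(8 * k) ^ k` register columns of a gadget of arity `k` are polynomially many. -/
def gadgetArity (n : ℕ) : ℕ := Nat.sqrt (Nat.log 2 n) + 1

theorem log_log_le_log_gadgetArity {n : ℕ} (hn : 1 < Real.log n) :
    Real.log (Real.log n) ≤ 2 * Real.log (gadgetArity n + 1 : ℕ) := by
  have hlog : Real.log n ≤ (Nat.log 2 n + 1 : ℕ) :=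
    calc Real.log n ≤ Real.logb (2 : ℕ) n :=
          le_div_self (by linarith) (Real.log_pos (by norm_num))
            (by rw [Nat.cast_two]; linarith [Real.log_two_lt_d9])
      _ ≤ (Nat.log 2 n + 1 : ℕ) := by
          refine (Nat.lt_floor_add_one _).le.trans_eq ?_
          rw [Real.natFloor_logb_natCast, Nat.cast_succ]
  have harity : Nat.log 2 n + 1 ≤ (gadgetArity n + 1) ^ 2 := by
    have := Nat.lt_succ_sqrt' (Nat.log 2 n)
    rw [gadgetArity]
    lia
  calc Real.log (Real.log n) ≤ Real.log ((gadgetArity n + 1 : ℕ) ^ 2) :=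
        Real.log_le_log (by linarith) (hlog.trans (by exact_mod_cast harity))
    _ = 2 * Real.log (gadgetArity n + 1 : ℕ) := by rw [Real.log_pow, Nat.cast_two]

theorem isBigO_depth_log_div_log_log (c : ℕ) :
    (fun n => ((3 * (c * Nat.clog (gadgetArity n + 1) n + 1) : ℕ) : ℝ)) =O[atTop]
      fun n : ℕ => Real.log n / Real.log (Real.log n) := by
  refine isBigO_depth (K := fun n => gadgetArity n + 1) c (IsBigO.of_bound 2 ?_)
    (IsBigO.of_bound 1 ?_)
  · filter_upwards [eventually_one_lt_log] with n hn
    have hloglog : 0 < Real.log (Real.log n) := Real.log_pos hn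
    have harity := log_log_le_log_gadgetArity hn
    rw [Real.logb, Real.norm_of_nonneg (div_nonneg (by linarith) (by linarith)),
      Real.norm_of_nonneg (div_nonneg (by linarith) hloglog.le), mul_div_assoc', mul_comm,
      div_le_div_iff₀ (by linarith) hloglog, mul_assoc]
    exact mul_le_mul_of_nonneg_left harity (by linarith)
  · filter_upwards [eventually_one_lt_log] with n hn
    have hloglog : 0 < Real.log (Real.log n) := Real.log_pos hn
    have := Real.log_le_sub_one_of_pos (zero_lt_one.trans hn)
    rw [norm_one, one_mul, Real.norm_of_nonneg (by positivity), one_le_div hloglog]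
    linarith

theorem eight_mul_le_two_pow {k : ℕ} (hk : 1 ≤ k) : 8 * k ≤ 2 ^ (4 * k) :=
  calc 8 * k ≤ 2 ^ 3 * 2 ^ k := Nat.mul_le_mul_left _ Nat.lt_two_pow_self.le
    _ = 2 ^ (3 + k) := (pow_add _ _ _).symm
    _ ≤ 2 ^ (4 * k) := Nat.pow_le_pow_right two_pos (by lia)

theorem gadgetArity_sq_le {n : ℕ} (hn : 2 ≤ n) : gadgetArity n ^ 2 ≤ 4 * Nat.log 2 n := by
  have hlog : 1 ≤ Nat.log 2 n := Nat.log_pos one_lt_two hn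
  have hsq := Nat.sqrt_le' (Nat.log 2 n)
  rw [gadgetArity]
  nlinarith [Nat.sqrt_pos.2 hlog]

theorem register_le_pow {n : ℕ} (hn : 2 ≤ n) :
    (8 * gadgetArity n) ^ gadgetArity n ≤ n ^ 16 :=
  calc (8 * gadgetArity n) ^ gadgetArity n ≤ (2 ^ (4 * gadgetArity n)) ^ gadgetArity n :=
        Nat.pow_le_pow_left (eight_mul_le_two_pow (Nat.le_add_left _ _)) _
    _ = 2 ^ (4 * gadgetArity n ^ 2) := by rw [← pow_mul, sq, mul_assoc]
    _ ≤ 2 ^ (Nat.log 2 n * 16) :=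
        Nat.pow_le_pow_right two_pos (by have := gadgetArity_sq_le hn; lia)
    _ = (2 ^ Nat.log 2 n) ^ 16 := pow_mul _ _ _
    _ ≤ n ^ 16 := Nat.pow_le_pow_left (Nat.pow_log_le_self 2 (by lia)) _

theorem gadgetArity_le {n : ℕ} (hn : n ≠ 0) : gadgetArity n ≤ n :=
  (Nat.sqrt_le_self _).trans_lt (Nat.log_lt_self 2 hn)

/-- The number of qubits of the tree of parity gadgets that adds up `n` bits. -/
def treeSize (n : ℕ) : ℕ :=
  ((gadgetArity n + 1) ^ Nat.clog (gadgetArity n + 1) n + 1) *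
    ((8 * gadgetArity n) ^ gadgetArity n * gadgetArity n + 2)

theorem treeSize_le {n : ℕ} (hn : 2 ≤ n) : treeSize n ≤ 9 * n ^ 19 := by
  have harity := gadgetArity_le (n := n) (by lia)
  have htree : (gadgetArity n + 1) ^ Nat.clog (gadgetArity n + 1) n ≤ 2 * n ^ 2 :=
    (pow_clog_le (by simp [gadgetArity]) hn).trans (by nlinarith)
  have hregister : (8 * gadgetArity n) ^ gadgetArity n * gadgetArity n ≤ n ^ 17 :=
    Nat.mul_le_mul (register_le_pow hn) harity
  have := Nat.one_le_pow 2 n (by lia)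
  have := Nat.one_le_pow 17 n (by lia)
  calc treeSize n ≤ (3 * n ^ 2) * (3 * n ^ 17) := Nat.mul_le_mul (by lia) (by lia)
    _ = 9 * n ^ 19 := by ring

theorem exists_circuit2D_treeSize (n : ℕ) :
    ∃ C : Circuit2D (treeSize n + 1) (treeSize n),
      C.depth = 3 * (54 * Nat.clog (gadgetArity n + 1) n + 1) ∧
        C.Synthesizes (parityUnitary n) := by
  have : NeZero (gadgetArity n) := ⟨Nat.succ_ne_zero _⟩
  have hJ := Fintype.card_fin ((8 * gadgetArity n) ^ gadgetArity n)
  have h := exists_circuit2D_treeQubits hJ (Nat.le_pow_clog (by simp [gadgetArity]) n)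
  rwa [card_treeQubits, hJ] at h

end Asymptotics

end QAC

theorem mainTheorem10 :
    (∀ n : ℕ, 1 ≤ n →
      ∃ C : QAC.Circuit1D (n + 1),
        C.depth = n ∧ C.Synthesizes (QAC.parityUnitary n)) ∧
    (∃ (d m : ℕ → ℕ) (c : ℕ),
      Asymptotics.IsBigO Filter.atTop (fun n => (d n : ℝ)) (fun n : ℕ => Real.log n) ∧
      Asymptotics.IsBigO Filter.atTop (fun n => (m n : ℝ)) (fun n : ℕ => (n : ℝ) ^ c) ∧
      ∀ n : ℕ, 1 ≤ n →
        ∃ C : QAC.Circuit2D 2 (m n),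
          C.depth = d n ∧ C.Synthesizes (QAC.parityUnitary n)) ∧
    (∃ (d w m : ℕ → ℕ) (c : ℕ),
      Asymptotics.IsBigO Filter.atTop (fun n => (d n : ℝ))
        (fun n : ℕ => Real.log n / Real.log (Real.log n)) ∧
      Asymptotics.IsBigO Filter.atTop (fun n => (w n : ℝ)) (fun n : ℕ => (n : ℝ) ^ c) ∧
      Asymptotics.IsBigO Filter.atTop (fun n => (m n : ℝ)) (fun n : ℕ => (n : ℝ) ^ c) ∧
      ∀ n : ℕ, 1 ≤ n →
        ∃ C : QAC.Circuit2D (w n) (m n),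
          C.depth = d n ∧ C.Synthesizes (QAC.parityUnitary n)) := by
  refine ⟨QAC.exists_circuit1D, ?_, ?_⟩
  · refine ⟨fun n => 3 * (2 * Nat.clog 2 n + 1), fun n => 2 ^ Nat.clog 2 n + 1, 1,
      QAC.isBigO_depth_log 2, QAC.isBigO_pow_of_le (a := 3) fun n hn => ?_, fun n _ =>
        QAC.exists_circuit2D_width_two n _ (Nat.le_pow_clog one_lt_two n)⟩
    linarith [QAC.pow_clog_le le_rfl hn]
  · refine ⟨fun n => 3 * (54 * Nat.clog (QAC.gadgetArity n + 1) n + 1),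
      fun n => QAC.treeSize n + 1, QAC.treeSize, 19, QAC.isBigO_depth_log_div_log_log 54,
      QAC.isBigO_pow_of_le (a := 10) fun n hn => ?_,
      QAC.isBigO_pow_of_le fun n hn => QAC.treeSize_le hn,
      fun n _ => QAC.exists_circuit2D_treeSize n⟩
    linarith [QAC.treeSize_le hn, Nat.one_le_pow 19 n (by lia)]
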